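/- **Conventions.** Let $E=(E^0,E^1,r,s)$ be a countable directed graph (countable vertex set $E^0$, countable edge set $E^1$, arbitrary range and source maps $r,s:E^1\to E^0$). Paths are words $\mu=\mu_1\mu_2\cdots$ of edges with $s(\mu_i)=r(\mu_{i+1})$; vertices are paths of length zero, $E^*$ is the set of finite paths and $E^\infty$ the set of infinite ones; $r(\mu)$ and (for finite $\mu$) $s(\mu)$ denote range and source. The boundary space $\partial E$ consists of the infinite paths together with the finite paths $\mu$ such that $r^{-1}(s(\mu))$ is infinite or empty, with the topology generated by the cylinders $D_\eta=\{\mu\in\partial E:\mu \text{ begins with } \eta\}$, $\eta\in E^*$, and their complements. The graph $C^*$-algebra $C^*(E)$ is generated by a universal Cuntz–Krieger $E$-family: mutually orthogonal projections $p_v$, $v\in E^0$, and partial isometries $s_e$, $e\in E^1$, with mutually orthogonal range projections such that $s_e^*s_e=p_{s(e)}$, $s_es_e^*\le p_{r(e)}$, and $p_v=\sum_{r(e)=v}s_es_e^*$ whenever $0<|r^{-1}(v)|<\infty$. For $\mu=\mu_1\cdots\mu_n\in E^*$ put $s_\mu=s_{\mu_1}\cdots s_{\mu_n}$, and $s_v=p_v$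 for a vertex $v$. Let $\mathcal D_E\subseteq C^*(E)$ be the $C^*$-subalgebra generated by the projections $s_\mu s_\mu^*$, $\mu\in E^*$. Sums over infinite index sets are limits of the nets of finite partial sums. **Proposition.** Let $\lambda=\{\lambda_e\}_{e\in E^1}$ be a family of strictly positive real numbers. The following conditions are equivalent: (i) the formula $$\mathcal L_\lambda(a)(\mu)=\sum_{e\in E^1,\ e\mu\in\partial E}\lambda_e\,a(e\mu),\qquad a\in C_0(\partial E),\ \mu\in\partial E,$$ defines a bounded operator $\mathcal L_\lambda:C_0(\partial E)\to C_0(\partial E)$; (ii) all the sums below are finite and $$\Big\{\sum_{e\in s^{-1}(v)}\lambda_e\Big\}_{v\in s(E^1)}\in\ell_\infty(s(E^1)),\qquad \Big\{\sum_{e\in r^{-1}(v)\cap s^{-1}(w)}\lambda_e\Big\}_{w\in s(r^{-1}(v))}\in c_0\big(s(r^{-1}(v))\big)\ \text{ for all } v\in r(E^1);$$ (iii) the sum $u_\lambda:=\sum_{e\in E^1}\sqrt{\lambda_e}\,s_e$ converges strictly in the multiplier algebra $M(C^*(E))$; (iv) for every $a\in C^*(E)$ the sum $$\Phi_{*,\lambda}(a):=\sum_{e,f\in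 E^1}\sqrt{\lambda_e\lambda_f}\,s_e^*as_f=\lim_{F}\sum_{e,f\in F}\sqrt{\lambda_e\lambda_f}\,s_e^*as_f$$ converges in norm, the limit being taken over the finite sets $F\subseteq E^1$ directed by inclusion, and $a\mapsto \Phi_{*,\lambda}(a)$ is a completely positive map $\Phi_{*,\lambda}:C^*(E)\to C^*(E)$. If these equivalent conditions hold, then $\Phi_{*,\lambda}(a)=u_\lambda^*au_\lambda$ for all $a\in C^*(E)$; moreover $\Phi_{*,\lambda}(\mathcal D_E)\subseteq\mathcal D_E$, and there is a $*$-isomorphism $\psi:\mathcal D_E\to C_0(\partial E)$ with $\psi(s_\mu s_\mu^*)=\chi_{D_\mu}$ for all $\mu\in E^*$ (necessarily unique), which satisfies $\psi(\Phi_{*,\lambda}(a))=\mathcal L_\lambda(\psi(a))$ for all $a\in\mathcal D_E$. -/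

import Mathlib

open scoped ENNReal ZeroAtInfty MultiplierAlgebra CStarAlgebra
open Filter Topology

universe u v w

/-- A directed graph with vertex set `V`, edge set `Edge`, range map `r` and source map `s`. -/
structure DirGraph (V : Type u) (Edge : Type v) where
  r : Edge → V
  s : Edge → V

namespace DirGraph

variable {V : Type u} {Edge : Type v}

/-! ### Paths and the boundary space -/

/-- `E.IsPath v [μ₁, …, μₙ]`: the edges satisfy `r μ₁ = v` (if `n > 0`) and
`s μᵢ = r μᵢ₊₁` for `1 ≤ i < n`. -/
def IsPath (E : DirGraph V Edge) : V → List Edge → Prop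
  | _, [] => True
  | v, e :: l => E.r e = v ∧ E.IsPath (E.s e) l

/-- The source of the path with range `v` and list of edges `l`. -/
def pathSource (E : DirGraph V Edge) : V → List Edge → V
  | v, [] => v
  | _, e :: l => E.pathSource (E.s e) l

/-- Finite paths, recorded by their range and their list of edges; the vertex `v` is the path
with range `v` and no edges. -/
structure FinPath (E : DirGraph V Edge) where
  range : V
  edges : List Edge
  isPath : E.IsPath range edges

/-- The source of a finite path. -/
def FinPath.source {E : DirGraph V Edge} (μ : E.FinPath) : V := E.pathSource μ.range μ.edges

/-- Infinite paths `μ₁μ₂⋯` with `s μᵢ = r μᵢ₊₁` (indexed from `0`). -/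
structure InfPath (E : DirGraph V Edge) where
  edges : ℕ → Edge
  isPath : ∀ i, E.s (edges i) = E.r (edges (i + 1))

/-- The range of a finite or infinite path. -/
def pathRange (E : DirGraph V Edge) : E.FinPath ⊕ E.InfPath → V
  | Sum.inl μ => μ.range
  | Sum.inr μ => E.r (μ.edges 0)

/-- A path belongs to the boundary if it is infinite, or if it is finite and its source is an
infinite receiver or receives no edge. -/
def IsBoundary (E : DirGraph V Edge) : E.FinPath ⊕ E.InfPath → Prop
  | Sum.inl μ => {e | E.r e = μ.source}.Infinite ∨ {e | E.r e = μ.source} = ∅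
  | Sum.inr _ => True

/-- `E.IsInitial η μ`: the path `μ` begins with the finite path `η`. -/
def IsInitial (E : DirGraph V Edge) (η : E.FinPath) : E.FinPath ⊕ E.InfPath → Prop
  | Sum.inl μ => η.range = μ.range ∧ η.edges <+: μ.edges
  | Sum.inr μ => η.range = E.r (μ.edges 0) ∧
      ∀ i (h : i < η.edges.length), η.edges[i] = μ.edges i

/-- The boundary space `∂E`. -/
def Boundary (E : DirGraph V Edge) : Type (max u v) :=
  {μ : E.FinPath ⊕ E.InfPath // E.IsBoundary μ}

/-- The cylinder `D_η`. -/
def cylinder (E : DirGraph V Edge) (η : E.FinPath) : Set E.Boundary :=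
  {μ | E.IsInitial η μ.1}

/-- The topology on `∂E` generated by the cylinders and their complements. -/
instance (E : DirGraph V Edge) : TopologicalSpace E.Boundary :=
  TopologicalSpace.generateFrom
    (Set.range E.cylinder ∪ Set.range fun η => (E.cylinder η)ᶜ)

/-- The range of a boundary path. -/
def Boundary.range {E : DirGraph V Edge} (μ : E.Boundary) : V := E.pathRange μ.1

/-- The path `eμ`, for `s e = r μ`. -/
def consPath (E : DirGraph V Edge) (e : Edge) :
    (μ : E.FinPath ⊕ E.InfPath) → E.s e = E.pathRange μ → E.FinPath ⊕ E.InfPath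
  | Sum.inl μ, h => Sum.inl
      { range := E.r e
        edges := e :: μ.edges
        isPath := ⟨rfl, h.symm ▸ μ.isPath⟩ }
  | Sum.inr μ, h => Sum.inr
      { edges := fun i => Nat.casesOn i e μ.edges
        isPath := fun i => by
          cases i with
          | zero => exact h
          | succ i => exact μ.isPath i }

theorem isBoundary_consPath (E : DirGraph V Edge) (e : Edge) (μ : E.FinPath ⊕ E.InfPath)
    (h : E.s e = E.pathRange μ) (hμ : E.IsBoundary μ) : E.IsBoundary (E.consPath e μ h) := by
  cases μ with
  | inr μ => trivial
  | inl μ =>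
    have h' : E.s e = μ.range := h
    have hs : E.pathSource (E.s e) μ.edges = μ.source := by rw [h']; rfl
    change {f | E.r f = E.pathSource (E.s e) μ.edges}.Infinite ∨
      {f | E.r f = E.pathSource (E.s e) μ.edges} = ∅
    rw [hs]
    exact hμ

/-- The boundary path `eμ`, for `μ ∈ ∂E` and `s e = r μ`. -/
def Boundary.cons {E : DirGraph V Edge} (e : Edge) (μ : E.Boundary) (h : E.s e = μ.range) :
    E.Boundary :=
  ⟨E.consPath e μ.1 h, E.isBoundary_consPath e μ.1 h μ.2⟩

/-! ### The graph C⋆-algebra -/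

/-- A Cuntz–Krieger `E`-family in a C⋆-algebra `B`: mutually orthogonal projections `p v` and
elements `s e` with `(s e)⋆ (s e) = p (s e)` (so the `s e` are partial isometries) whose range
projections `(s e) (s e)⋆` are mutually orthogonal, lie below `p (r e)`, and sum to `p v` over
`r⁻¹(v)` whenever this set is finite and nonempty. -/
structure CKFamily (E : DirGraph V Edge) (B : Type w) [NonUnitalCStarAlgebra B] where
  p : V → B
  s : Edge → B
  isStarProjection_p : ∀ v, IsStarProjection (p v)
  p_mul_p : ∀ v v', v ≠ v' → p v * p v' = 0
  star_s_mul_s : ∀ e, star (s e) * s e = p (E.s e)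
  range_mul_range : ∀ e f, e ≠ f → (s e * star (s e)) * (s f * star (s f)) = 0
  p_mul_range : ∀ e, p (E.r e) * (s e * star (s e)) = s e * star (s e)
  p_eq_sum : ∀ v (h : {e | E.r e = v}.Finite), {e | E.r e = v}.Nonempty →
    p v = ∑ e ∈ h.toFinset, s e * star (s e)

namespace CKFamily

variable {E : DirGraph V Edge} {B : Type w} [NonUnitalCStarAlgebra B]

theorem norm_p_le (F : E.CKFamily B) (v : V) : ‖F.p v‖ ≤ 1 := by
  have h := CStarRing.norm_star_mul_self (x := F.p v)
  rw [(F.isStarProjection_p v).isSelfAdjoint.star_eq,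
    (F.isStarProjection_p v).isIdempotentElem.eq] at h
  nlinarith [norm_nonneg (F.p v)]

theorem norm_s_le (F : E.CKFamily B) (e : Edge) : ‖F.s e‖ ≤ 1 := by
  have h := CStarRing.norm_star_mul_self (x := F.s e)
  rw [F.star_s_mul_s] at h
  nlinarith [norm_nonneg (F.s e), F.norm_p_le (E.s e)]

/-- The element `s_μ = s_{μ₁} ⋯ s_{μₙ}` for the path with range `v` and edges `μ₁, …, μₙ`, and
`p v` for the vertex `v`. (The final factor `p (s μₙ)` changes nothing, as
`s e * p (s e) = s e`.) -/
def listElem (F : E.CKFamily B) : V → List Edge → B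
  | v, [] => F.p v
  | _, e :: l => F.s e * F.listElem (E.s e) l

/-- The element `s_μ` of a finite path `μ`. -/
def pathElem (F : E.CKFamily B) (μ : E.FinPath) : B := F.listElem μ.range μ.edges

theorem s_mul_p (F : E.CKFamily B) (e : Edge) : F.s e * F.p (E.s e) = F.s e := by
  have hp := F.isStarProjection_p (E.s e)
  rw [← sub_eq_zero, ← CStarRing.star_mul_self_eq_zero_iff, star_sub, star_mul,
    hp.isSelfAdjoint.star_eq]
  simp only [sub_mul, mul_sub, mul_assoc, F.star_s_mul_s, hp.isIdempotentElem.eq]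
  simp only [← mul_assoc, F.star_s_mul_s, hp.isIdempotentElem.eq, sub_self]

end CKFamily

/-- A Cuntz–Krieger `E`-family together with the C⋆-algebra in which it lives. -/
structure CKRep (E : DirGraph V Edge) : Type (max u v + 1) where
  alg : Type (max u v)
  [inst : NonUnitalCStarAlgebra alg]
  fam : E.CKFamily alg

attribute [instance] CKRep.inst

/-- The direct product (of bounded families) of all C⋆-algebras carrying a Cuntz–Krieger
`E`-family. -/
abbrev BigProd (E : DirGraph V Edge) : Type (max u v + 1) :=
  lp (fun i : E.CKRep => i.alg) ∞

/-- The projection at `v` of the product of all Cuntz–Krieger `E`-families. -/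
def bigP (E : DirGraph V Edge) (v : V) : E.BigProd :=
  ⟨fun i => i.fam.p v, memℓp_infty ⟨1, by rintro _ ⟨i, rfl⟩; exact i.fam.norm_p_le v⟩⟩

/-- The partial isometry at `e` of the product of all Cuntz–Krieger `E`-families. -/
def bigS (E : DirGraph V Edge) (e : Edge) : E.BigProd :=
  ⟨fun i => i.fam.s e, memℓp_infty ⟨1, by rintro _ ⟨i, rfl⟩; exact i.fam.norm_s_le e⟩⟩

/-- The C⋆-subalgebra generated by the product of all Cuntz–Krieger `E`-families. -/
noncomputable def universalSubalgebra (E : DirGraph V Edge) :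
    NonUnitalStarSubalgebra ℂ E.BigProd :=
  (NonUnitalStarAlgebra.adjoin ℂ (Set.range E.bigP ∪ Set.range E.bigS)).topologicalClosure

/-- The graph C⋆-algebra `C⋆(E)`: the C⋆-algebra generated by the universal Cuntz–Krieger
`E`-family, the latter being realised as the product of all Cuntz–Krieger `E`-families. -/
def GraphCStar (E : DirGraph V Edge) : Type (max u v + 1) := E.universalSubalgebra

noncomputable instance (E : DirGraph V Edge) : NonUnitalCStarAlgebra E.GraphCStar :=
  NonUnitalStarSubalgebra.nonUnitalCStarAlgebra E.universalSubalgebra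
    (h_closed := NonUnitalStarSubalgebra.isClosed_topologicalClosure _)

/-- The standard order of a C⋆-algebra, with positive elements the elements `star a * a`. -/
noncomputable instance (E : DirGraph V Edge) : PartialOrder E.GraphCStar :=
  CStarAlgebra.spectralOrder _

instance (E : DirGraph V Edge) : StarOrderedRing E.GraphCStar :=
  CStarAlgebra.spectralOrderedRing _

theorem bigProd_ext {E : DirGraph V Edge} {x y : E.BigProd} (h : ∀ i, x i = y i) : x = y :=
  lp.ext (funext h)

/-- Evaluation of an element of `C⋆(E)` at one of the Cuntz–Krieger families. -/
noncomputable def evalRep (E : DirGraph V Edge) (i : E.CKRep) : E.GraphCStar →⋆ₙₐ[ℂ] i.alg where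
  toFun x := (show E.universalSubalgebra from x).1 i
  map_smul' _ _ := rfl
  map_zero' := rfl
  map_add' _ _ := rfl
  map_mul' _ _ := rfl
  map_star' _ := rfl

theorem evalRep_ext {E : DirGraph V Edge} {x y : E.GraphCStar}
    (h : ∀ i, E.evalRep i x = E.evalRep i y) : x = y :=
  Subtype.ext (bigProd_ext h)

/-- The universal Cuntz–Krieger `E`-family, in `C⋆(E)`. -/
noncomputable def univ (E : DirGraph V Edge) : E.CKFamily E.GraphCStar where
  p v := ⟨E.bigP v, NonUnitalStarSubalgebra.le_topologicalClosure _
    (NonUnitalStarAlgebra.subset_adjoin ℂ _ (Or.inl ⟨v, rfl⟩))⟩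
  s e := ⟨E.bigS e, NonUnitalStarSubalgebra.le_topologicalClosure _
    (NonUnitalStarAlgebra.subset_adjoin ℂ _ (Or.inr ⟨e, rfl⟩))⟩
  isStarProjection_p v :=
    ⟨evalRep_ext fun i => (i.fam.isStarProjection_p v).isIdempotentElem,
      evalRep_ext fun i => (i.fam.isStarProjection_p v).isSelfAdjoint⟩
  p_mul_p v v' h := evalRep_ext fun i => i.fam.p_mul_p v v' h
  star_s_mul_s e := evalRep_ext fun i => i.fam.star_s_mul_s e
  range_mul_range e f h := evalRep_ext fun i => i.fam.range_mul_range e f h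
  p_mul_range e := evalRep_ext fun i => i.fam.p_mul_range e
  p_eq_sum v h hne := evalRep_ext fun i => by
    rw [map_sum]
    exact i.fam.p_eq_sum v h hne

/-- The universal property of `C⋆(E)`. -/
theorem existsUnique_lift (E : DirGraph V Edge) {B : Type (max u v)} [NonUnitalCStarAlgebra B]
    (F : E.CKFamily B) :
    ∃! π : E.GraphCStar →⋆ₙₐ[ℂ] B,
      (∀ v, π (E.univ.p v) = F.p v) ∧ ∀ e, π (E.univ.s e) = F.s e := by
  refine ⟨E.evalRep ⟨B, F⟩, ⟨fun _ => rfl, fun _ => rfl⟩, fun π hπ => ?_⟩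
  set π' := E.evalRep ⟨B, F⟩
  have hmem : ∀ x ∈ NonUnitalStarAlgebra.adjoin ℂ (Set.range E.bigP ∪ Set.range E.bigS),
      x ∈ E.universalSubalgebra := fun x hx => NonUnitalStarSubalgebra.le_topologicalClosure _ hx
  have key : ∀ x (hx : x ∈ NonUnitalStarAlgebra.adjoin ℂ (Set.range E.bigP ∪ Set.range E.bigS)),
      π (⟨x, hmem x hx⟩ : E.universalSubalgebra) =
        π' (⟨x, hmem x hx⟩ : E.universalSubalgebra) := by
    intro x hx
    induction hx using NonUnitalStarAlgebra.adjoin_induction with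
    | mem x hx =>
      rcases hx with ⟨v, rfl⟩ | ⟨e, rfl⟩
      · exact hπ.1 v
      · exact hπ.2 e
    | add x y hx hy ihx ihy =>
      have h1 := map_add π (⟨x, hmem x hx⟩ : E.universalSubalgebra) ⟨y, hmem y hy⟩
      have h2 := map_add π' (⟨x, hmem x hx⟩ : E.universalSubalgebra) ⟨y, hmem y hy⟩
      exact h1.trans ((congrArg₂ (· + ·) ihx ihy).trans h2.symm)
    | zero => exact (map_zero π).trans (map_zero π').symm
    | mul x y hx hy ihx ihy =>
      have h1 := map_mul π (⟨x, hmem x hx⟩ : E.universalSubalgebra) ⟨y, hmem y hy⟩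
      have h2 := map_mul π' (⟨x, hmem x hx⟩ : E.universalSubalgebra) ⟨y, hmem y hy⟩
      exact h1.trans ((congrArg₂ (· * ·) ihx ihy).trans h2.symm)
    | smul c x hx ih =>
      have h1 := map_smul π c (⟨x, hmem x hx⟩ : E.universalSubalgebra)
      have h2 := map_smul π' c (⟨x, hmem x hx⟩ : E.universalSubalgebra)
      exact h1.trans ((congrArg (c • ·) ih).trans h2.symm)
    | star x hx ih =>
      have h1 := map_star π (⟨x, hmem x hx⟩ : E.universalSubalgebra)
      have h2 := map_star π' (⟨x, hmem x hx⟩ : E.universalSubalgebra)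
      exact h1.trans ((congrArg star ih).trans h2.symm)
  have hc : Continuous π := map_continuous π
  have hc' : Continuous π' := map_continuous π'
  refine NonUnitalStarAlgHom.ext fun y => ?_
  obtain ⟨x, hx, hlim⟩ := mem_closure_iff_seq_limit.1
    (show (y.1 : E.BigProd) ∈ closure _ from y.2)
  have hlim' : Tendsto (fun n => (⟨x n, hmem _ (hx n)⟩ : E.GraphCStar)) atTop (𝓝 y) :=
    tendsto_subtype_rng.2 hlim
  exact tendsto_nhds_unique ((hc.tendsto y).comp hlim')
    (((hc'.tendsto y).comp hlim').congr fun n => (key _ (hx n)).symm)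

/-- The diagonal C⋆-subalgebra `D_E` of `C⋆(E)`, generated by the projections `s_μ s_μ⋆`. -/
noncomputable def diagonal (E : DirGraph V Edge) : NonUnitalStarSubalgebra ℂ E.GraphCStar :=
  (NonUnitalStarAlgebra.adjoin ℂ
    (Set.range fun μ : E.FinPath =>
      E.univ.pathElem μ * star (E.univ.pathElem μ))).topologicalClosure

/-- The projection `s_μ s_μ⋆` as an element of `D_E`. -/
noncomputable def diagProj (E : DirGraph V Edge) (μ : E.FinPath) : E.diagonal :=
  ⟨E.univ.pathElem μ * star (E.univ.pathElem μ),
    NonUnitalStarSubalgebra.le_topologicalClosure _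
      (NonUnitalStarAlgebra.subset_adjoin ℂ _ ⟨μ, rfl⟩)⟩

/-! ### The conditions of the theorem -/

/-- `L` is the operator `L_λ` on `C₀(∂E)`: for all `a` and `μ` the series
`∑_{e, eμ ∈ ∂E} λ_e a(eμ)` converges (unconditionally) to `(L a)(μ)`. -/
def IsTransferOperator (E : DirGraph V Edge) (lam : Edge → ℝ)
    (L : C₀(E.Boundary, ℂ) →L[ℂ] C₀(E.Boundary, ℂ)) : Prop :=
  ∀ (a : C₀(E.Boundary, ℂ)) (μ : E.Boundary),
    HasSum (fun e : {e : Edge // E.s e = μ.range} => (lam e : ℂ) * a (μ.cons e.1 e.2)) (L a μ)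

/-- The family `{∑_{e ∈ s⁻¹(v)} λ_e}_{v ∈ s(E¹)}` consists of finite numbers and belongs to
`ℓ^∞`. -/
def SourceSumsBounded (E : DirGraph V Edge) (lam : Edge → ℝ) : Prop :=
  (∀ v ∈ Set.range E.s, Summable fun e : {e : Edge // E.s e = v} => lam e) ∧
  Memℓp (fun v : Set.range E.s => ∑' e : {e : Edge // E.s e = v}, lam e) ∞

/-- For every `v ∈ r(E¹)`, the family `{∑_{e ∈ r⁻¹(v) ∩ s⁻¹(w)} λ_e}_{w ∈ s(r⁻¹(v))}` consists of
finite numbers and belongs to `c₀`. -/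
def RangeSumsVanish (E : DirGraph V Edge) (lam : Edge → ℝ) : Prop :=
  ∀ v ∈ Set.range E.r,
    (∀ w ∈ E.s '' {e | E.r e = v},
      Summable fun e : {e : Edge // E.r e = v ∧ E.s e = w} => lam e) ∧
    Tendsto (fun w : E.s '' {e | E.r e = v} =>
      ∑' e : {e : Edge // E.r e = v ∧ E.s e = w}, lam e) cofinite (𝓝 0)

end DirGraph

/-- The strict topology on the multiplier algebra of `A`: the coarsest topology for which the maps
`m ↦ m a` and `m ↦ a m` into `A` with its norm topology are continuous, for all `a : A`. -/
noncomputable abbrev strictTopology (A : Type w) [NonUnitalCStarAlgebra A] : TopologicalSpace 𝓜(ℂ, A) :=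
  ⨅ a : A, TopologicalSpace.induced (fun m : 𝓜(ℂ, A) => m.fst a) inferInstance ⊓
    TopologicalSpace.induced (fun m : 𝓜(ℂ, A) => m.snd a) inferInstance

/-- The series `∑ i, f i` converges strictly to `m`: the net of its finite partial sums tends to
`m` in the strict topology. -/
def HasStrictSum {ι : Type v} {A : Type w} [NonUnitalCStarAlgebra A] (f : ι → 𝓜(ℂ, A))
    (m : 𝓜(ℂ, A)) : Prop :=
  Tendsto (fun F : Finset ι => ∑ i ∈ F, f i) atTop (@nhds _ (strictTopology A) m)

namespace DirGraph

variable {V : Type u} {Edge : Type v}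

/-- `u_λ = ∑ √λ_e s_e`, strictly convergent in the multiplier algebra of `C⋆(E)`. -/
def IsULambda (E : DirGraph V Edge) (lam : Edge → ℝ) (m : 𝓜(ℂ, E.GraphCStar)) : Prop :=
  HasStrictSum (fun e : Edge =>
    (((√(lam e) : ℝ) : ℂ) • E.univ.s e : 𝓜(ℂ, E.GraphCStar))) m

/-- `Φ a = ∑_{e,f} √(λ_e λ_f) s_e⋆ a s_f` in norm for every `a`: the net of the partial sums over
`e, f ∈ F`, indexed by the finite sets `F` of edges, converges in norm to `Φ a`. -/
def IsPerronFrobenius (E : DirGraph V Edge) (lam : Edge → ℝ)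
    (Φ : E.GraphCStar →CP E.GraphCStar) : Prop :=
  ∀ a : E.GraphCStar,
    Tendsto (fun F : Finset Edge => ∑ e ∈ F, ∑ f ∈ F,
        ((√(lam e * lam f) : ℝ) : ℂ) • (star (E.univ.s e) * a * E.univ.s f))
      atTop (𝓝 (Φ a))

end DirGraph

namespace DirGraph

variable {V : Type u} {Edge : Type v} {E : DirGraph V Edge}

/-! ### Finite paths -/

/-! The implications run in the cycle (i) → (ii) → (iii) → (iv) → (i). (i) → (ii): apply L to a
finite sum of functions χ_{D_e} over edges e with source v. These are disjoint cylinders, so the sum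
has norm at most 1, and its image at a boundary path with range v is the partial sum of the λ_e;
hence all partial sums are at most ‖L‖. For the second family use χ_{D_v}: L χ_{D_v} at μ is the sum
of λ_e over r(e) = v, s(e) = r(μ). This depends only on r(μ), and a compact set meets only finitely
many D_w, so vanishing at infinity gives c₀. (ii) → (iii): for finite F put u_F = ∑_{e ∈ F} √λ_e
s_e. Then u_F⋆ u_F = ∑_{e ∈ F} λ_e p_{s(e)}, a combination of orthogonal projections of norm 1, so
‖u_F‖² is the largest of the sums of λ_e over e ∈ F with fixed source (`norm_sum_uTerm_sq_le_iff`).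
This bounds u_F and gives the Cauchy criterion for u_F p_v and p_v u_F; boundedness carries
convergence from the generators to all of C⋆(E). (iii) → (iv): the norm formula and strict
convergence give ‖u_F‖ ≤ ‖u_λ‖, whence u_F⋆ a u_F → u_λ⋆ a u_λ, and a ↦ u_λ⋆ a u_λ is completely
positive. (iv) → (i): for a in D_E the terms s_e⋆ a s_f with e ≠ f vanish, Φ preserves D_E, and
ψ(s_e⋆ a s_e)(μ) = ψ(a)(eμ); so ψ carries Φ to L. Boundedness is automatic for positive maps. The
isomorphism ψ comes from the representation on ℓ²(∂E) in which s_e prepends e: it takes s_η s_η⋆ to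
multiplication by χ_{D_η}. It is onto by Stone–Weierstrass and injective because every nonzero
character of D_E is evaluation at a boundary path. The combinatorial core is
`exists_boundary_of_chain`, which serves both this and the compactness of cylinders. -/

theorem isPath_append {v : V} {l l' : List Edge} :
    E.IsPath v (l ++ l') ↔ E.IsPath v l ∧ E.IsPath (E.pathSource v l) l' := by
  induction l generalizing v with
  | nil => simp [IsPath, pathSource]
  | cons e l ih => simp [IsPath, pathSource, ih, and_assoc]

theorem pathSource_append {v : V} {l l' : List Edge} :
    E.pathSource v (l ++ l') = E.pathSource (E.pathSource v l) l' := by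
  induction l generalizing v with
  | nil => rfl
  | cons e l ih => exact ih

theorem IsPath.r_getElem_zero {v : V} {l : List Edge} (h : E.IsPath v l) (h0 : 0 < l.length) :
    E.r l[0] = v := by
  cases l with
  | nil => simp at h0
  | cons e l => exact h.1

theorem IsPath.s_getElem {v : V} {l : List Edge} (h : E.IsPath v l) {i : ℕ}
    (hi : i + 1 < l.length) : E.s l[i] = E.r l[i + 1] := by
  induction l generalizing v i with
  | nil => simp at hi
  | cons e l ih =>
    cases i with
    | zero => exact (h.2.r_getElem_zero (by simpa using hi)).symm
    | succ i => exact ih h.2 (by simpa using hi)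

/-- The path `ηe`, for `r e = s η`. -/
def FinPath.snoc (η : E.FinPath) (e : Edge) (h : E.r e = η.source) : E.FinPath where
  range := η.range
  edges := η.edges ++ [e]
  isPath := isPath_append.2 ⟨η.isPath, h, trivial⟩

/-- The path of length zero at `v`. -/
def FinPath.vertex (E : DirGraph V Edge) (v : V) : E.FinPath := ⟨v, [], trivial⟩

/-- The path `eη`, for `s e = r η`. -/
def FinPath.cons (e : Edge) (η : E.FinPath) (h : E.s e = η.range) : E.FinPath :=
  ⟨E.r e, e :: η.edges, rfl, h ▸ η.isPath⟩

theorem FinPath.ext_iff' {η ν : E.FinPath} :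
    η = ν ↔ η.range = ν.range ∧ η.edges = ν.edges := by
  cases η; cases ν; simp

theorem IsInitial.trans {η ν : E.FinPath} {μ : E.FinPath ⊕ E.InfPath}
    (h : E.IsInitial η (Sum.inl ν)) (h' : E.IsInitial ν μ) : E.IsInitial η μ := by
  cases μ with
  | inl μ => exact ⟨h.1.trans h'.1, h.2.trans h'.2⟩
  | inr μ =>
    refine ⟨h.1.trans h'.1, fun i hi => ?_⟩
    rw [← h'.2 i (hi.trans_le h.2.length_le)]
    exact h.2.getElem hi

theorem IsInitial.comparable {η ν : E.FinPath} {μ : E.FinPath ⊕ E.InfPath}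
    (h : E.IsInitial η μ) (h' : E.IsInitial ν μ) :
    E.IsInitial η (Sum.inl ν) ∨ E.IsInitial ν (Sum.inl η) := by
  cases μ with
  | inl μ =>
    exact (List.prefix_or_prefix_of_prefix h.2 h'.2).imp (fun k => ⟨h.1.trans h'.1.symm, k⟩)
      fun k => ⟨h'.1.trans h.1.symm, k⟩
  | inr μ =>
    rcases le_total η.edges.length ν.edges.length with hl | hl
    · refine Or.inl ⟨h.1.trans h'.1.symm, List.prefix_iff_getElem.2 ⟨hl, fun i hi => ?_⟩⟩
      rw [h.2 i hi, h'.2 i (hi.trans_le hl)]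
    · refine Or.inr ⟨h'.1.trans h.1.symm, List.prefix_iff_getElem.2 ⟨hl, fun i hi => ?_⟩⟩
      rw [h'.2 i hi, h.2 i (hi.trans_le hl)]

/-- A nonempty chain of finite paths that is closed under initial segments, and in which paths
whose source receives finitely many edges, but at least one, can be extended, consists of the
initial segments of a boundary path. -/
theorem exists_boundary_of_chain (S : Set E.FinPath) (hne : S.Nonempty)
    (hpre : ∀ η ν, E.IsInitial η (Sum.inl ν) → ν ∈ S → η ∈ S)
    (hchain : ∀ η ∈ S, ∀ ν ∈ S, E.IsInitial η (Sum.inl ν) ∨ E.IsInitial ν (Sum.inl η))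
    (hext : ∀ η ∈ S, {e | E.r e = η.source}.Finite → {e | E.r e = η.source}.Nonempty →
      ∃ e, ∃ h : E.r e = η.source, η.snoc e h ∈ S) :
    ∃ μ : E.Boundary, ∀ η, E.IsInitial η μ.1 ↔ η ∈ S := by
  -- A longest member of S is itself the required boundary path; if there is none, S contains
  -- arbitrarily long paths and they are glued to an infinite one.
  by_cases hb : ∃ η ∈ S, ∀ ν ∈ S, ν.edges.length ≤ η.edges.length
  · obtain ⟨η, hη, hmax⟩ := hb
    refine ⟨⟨Sum.inl η, ?_⟩, fun ν => ⟨fun h => hpre ν η h hη, fun h => ?_⟩⟩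
    · by_contra hcon
      simp only [IsBoundary, not_or, Set.not_infinite] at hcon
      obtain ⟨e, he, hS⟩ := hext η hη hcon.1 (Set.nonempty_iff_ne_empty.2 hcon.2)
      have := hmax _ hS
      simp [FinPath.snoc] at this
    · rcases hchain ν h η hη with h' | h'
      · exact h'
      · exact ⟨h'.1.symm, by rw [h'.2.eq_of_length_le (hmax ν h)]⟩
  · push Not at hb
    have hlong : ∀ n : ℕ, ∃ ν ∈ S, n < ν.edges.length := by
      intro n
      induction n with
      | zero =>
        obtain ⟨η, hη⟩ := hne
        obtain ⟨ν, hν, h⟩ := hb η hη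
        exact ⟨ν, hν, by omega⟩
      | succ n ih =>
        obtain ⟨η, hη, hn⟩ := ih
        obtain ⟨ν, hν, h⟩ := hb η hη
        exact ⟨ν, hν, by omega⟩
    -- The i-th edge of the limit is read off a member ν i with more than i edges; since S is a
    -- chain, `hedge` makes this independent of the choice.
    choose ν hνS hν using hlong
    have hedge : ∀ η ∈ S, ∀ i (hi : i < η.edges.length), η.edges[i] = (ν i).edges[i]'(hν i) := by
      intro η hη i hi
      rcases hchain η hη (ν i) (hνS i) with h | h
      · exact h.2.getElem hi
      · exact (h.2.getElem (hν i)).symm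
    have hrange : ∀ η ∈ S, η.range = E.r ((ν 0).edges[0]'(hν 0)) := by
      intro η hη
      rw [(ν 0).isPath.r_getElem_zero (hν 0)]
      rcases hchain η hη (ν 0) (hνS 0) with h | h
      · exact h.1
      · exact h.1.symm
    refine ⟨⟨Sum.inr ⟨fun i => (ν i).edges[i]'(hν i), fun i => ?_⟩, trivial⟩, fun η =>
      ⟨fun h => ?_, fun h => ⟨hrange η h, hedge η h⟩⟩⟩
    · rw [← hedge (ν (i + 1)) (hνS _) i ((Nat.lt_succ_self i).trans (hν _))]
      exact (ν (i + 1)).isPath.s_getElem (hν _)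
    · have hη : E.r ((ν 0).edges[0]'(hν 0)) = (ν η.edges.length).range :=
        (hrange _ (hνS _)).symm
      refine hpre η (ν η.edges.length) ⟨h.1.trans hη, List.prefix_iff_getElem.2
        ⟨(hν _).le, fun i hi => ?_⟩⟩ (hνS _)
      rw [hedge _ (hνS _) i (hi.trans (hν _))]
      exact h.2 i hi

/-- Every vertex is the range of a boundary path. -/
theorem exists_boundary_range_eq (E : DirGraph V Edge) (v : V) : ∃ μ : E.Boundary, μ.range = v := by
  -- R is the set of vertices at which a path with range v can end. If one of them receives no edge,
  -- stop there; otherwise choose a received edge at each of them and iterate.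
  let R : Set V := {w | ∃ l, E.IsPath v l ∧ E.pathSource v l = w}
  by_cases hs : ∃ w ∈ R, {e | E.r e = w} = ∅
  · obtain ⟨w, ⟨l, hl, rfl⟩, he⟩ := hs
    exact ⟨⟨Sum.inl ⟨v, l, hl⟩, Or.inr he⟩, rfl⟩
  · push Not at hs
    obtain ⟨f, hf⟩ : ∃ f : V → Edge, ∀ w ∈ R, E.r (f w) = w := by
      have : Nonempty Edge := (hs v ⟨[], trivial, rfl⟩).to_type
      choose! f hf using hs
      exact ⟨f, hf⟩
    have hR : ∀ w ∈ R, E.s (f w) ∈ R := by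
      rintro w ⟨l, hl, rfl⟩
      exact ⟨l ++ [f (E.pathSource v l)],
        isPath_append.2 ⟨hl, hf (E.pathSource v l) ⟨l, hl, rfl⟩, trivial⟩,
        by rw [pathSource_append]; rfl⟩
    let w : ℕ → V := fun n => Nat.rec v (fun _ w => E.s (f w)) n
    have hw : ∀ n, w n ∈ R := by
      intro n
      induction n with
      | zero => exact ⟨[], trivial, rfl⟩
      | succ n ih => exact hR _ ih
    exact ⟨⟨Sum.inr ⟨fun n => f (w n), fun n => (hf _ (hw (n + 1))).symm⟩, trivial⟩,
      hf _ (hw 0)⟩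

/-! ### Boundary paths -/

theorem mem_cylinder_vertex {v : V} {μ : E.Boundary} :
    μ ∈ E.cylinder (.vertex E v) ↔ μ.range = v := by
  rcases μ with ⟨μ | μ, hμ⟩
  · exact ⟨fun h => h.1.symm, fun h => ⟨h.symm, List.nil_prefix⟩⟩
  · exact ⟨fun h => h.1.symm, fun h => ⟨h.symm, fun i hi => absurd hi (Nat.not_lt_zero i)⟩⟩

theorem range_eq_of_mem_cylinder {η : E.FinPath} {μ : E.Boundary} (h : μ ∈ E.cylinder η) :
    μ.range = η.range := by
  rcases μ with ⟨μ | μ, hμ⟩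
  · exact h.1.symm
  · exact h.1.symm

@[simp]
theorem Boundary.range_cons (e : Edge) (μ : E.Boundary) (h : E.s e = μ.range) :
    (μ.cons e h).range = E.r e := by
  rcases μ with ⟨μ | μ, hμ⟩ <;> rfl

theorem Boundary.cons_injective {e : Edge} {μ μ' : E.Boundary} {h : E.s e = μ.range}
    {h' : E.s e = μ'.range} (hc : μ.cons e h = μ'.cons e h') : μ = μ' := by
  have hc := congrArg Subtype.val hc
  rcases μ with ⟨μ | μ, hμ⟩ <;> rcases μ' with ⟨μ' | μ', hμ'⟩
  · have h1 : E.s e = μ.range := h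
    have h2 : E.s e = μ'.range := h'
    have h3 := (FinPath.ext_iff'.1 (Sum.inl.inj hc)).2
    exact Subtype.ext (congrArg Sum.inl
      (FinPath.ext_iff'.2 ⟨h1.symm.trans h2, (List.cons.inj h3).2⟩))
  · exact absurd hc Sum.inl_ne_inr
  · exact absurd hc Sum.inr_ne_inl
  · have h3 := congrArg InfPath.edges (Sum.inr.inj hc)
    cases μ; cases μ'
    congr
    funext i
    exact congrFun h3 (i + 1)

theorem mem_cylinder_cons {e : Edge} {η : E.FinPath} {hη : E.s e = η.range} {μ : E.Boundary}
    {h : E.s e = μ.range} : μ.cons e h ∈ E.cylinder (η.cons e hη) ↔ μ ∈ E.cylinder η := by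
  rcases μ with ⟨μ | μ, hμ⟩
  · have h1 : E.s e = μ.range := h
    exact ⟨fun hh => ⟨hη.symm.trans h1, (List.cons_prefix_cons.1 hh.2).2⟩,
      fun hh => ⟨rfl, List.cons_prefix_cons.2 ⟨rfl, hh.2⟩⟩⟩
  · have h1 : E.s e = E.r (μ.edges 0) := h
    refine ⟨fun hh => ⟨hη.symm.trans h1, fun i hi => hh.2 (i + 1) (Nat.succ_lt_succ hi)⟩,
      fun hh => ⟨rfl, fun i hi => ?_⟩⟩
    cases i with
    | zero => rfl
    | succ i => exact hh.2 i (Nat.lt_of_succ_lt_succ hi)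

theorem mem_cylinder_cons_of_ne {e : Edge} {η : E.FinPath} {μ : E.Boundary} {f : Edge}
    {hη : E.s f = η.range} {h : E.s e = μ.range} (hef : e ≠ f) :
    μ.cons e h ∉ E.cylinder (η.cons f hη) := by
  rcases μ with ⟨μ | μ, hμ⟩
  · exact fun hh => hef (List.cons_prefix_cons.1 hh.2).1.symm
  · exact fun hh => hef (hh.2 0 (by simp [FinPath.cons])).symm

theorem exists_cons_of_mem_cylinder {e : Edge} {η : E.FinPath} {hη : E.s e = η.range}
    {μ : E.Boundary} (hμ : μ ∈ E.cylinder (η.cons e hη)) :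
    ∃ μ' : E.Boundary, ∃ h : E.s e = μ'.range, μ = μ'.cons e h := by
  rcases μ with ⟨⟨v, l, hl⟩ | ⟨f, hf⟩, hb⟩
  · obtain ⟨h1, h2⟩ := hμ
    simp only [FinPath.cons] at h1 h2
    cases l with
    | nil => simp at h2
    | cons e' l =>
      obtain ⟨rfl, -⟩ := List.cons_prefix_cons.1 h2
      subst h1
      exact ⟨⟨Sum.inl ⟨E.s e, l, hl.2⟩, hb⟩, rfl, rfl⟩
  · have h0 : e = f 0 := hμ.2 0 (by simp [FinPath.cons])
    subst h0
    refine ⟨⟨Sum.inr ⟨fun i => f (i + 1), fun i => hf (i + 1)⟩, trivial⟩, hf 0, ?_⟩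
    apply Subtype.ext
    simp only [Boundary.cons, consPath, Sum.inr.injEq, InfPath.mk.injEq]
    funext i
    cases i <;> rfl

/-- A boundary path whose range receives finitely many edges, but at least one, has a first
edge. -/
theorem Boundary.exists_eq_cons (μ : E.Boundary) (hfin : {e | E.r e = μ.range}.Finite)
    (hne : {e | E.r e = μ.range}.Nonempty) :
    ∃ e, ∃ μ' : E.Boundary, ∃ h : E.s e = μ'.range, μ = μ'.cons e h := by
  rcases μ with ⟨⟨v, l, hl⟩ | ⟨f, hf⟩, hb⟩
  · cases l with
    | nil => exact absurd hb (not_or.2 ⟨Set.not_infinite.2 hfin, hne.ne_empty⟩)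
    | cons e l =>
      obtain ⟨rfl, h2⟩ := hl
      exact ⟨e, ⟨Sum.inl ⟨E.s e, l, h2⟩, hb⟩, rfl, rfl⟩
  · refine ⟨f 0, exists_cons_of_mem_cylinder (η := .vertex E (E.s (f 0))) (hη := rfl) ?_⟩
    refine ⟨rfl, fun i hi => ?_⟩
    obtain rfl : i = 0 := by simpa [FinPath.cons, FinPath.vertex] using hi
    rfl

end DirGraph

namespace DirGraph

variable {V : Type u} {Edge : Type v} {E : DirGraph V Edge}

/-! ### The topology of the boundary space -/

/-- A boundary path that begins with η cannot stop at a vertex receiving finitely many edges but at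
least one, so it has a further edge. Thus D_η is then a finite union of the smaller cylinders
D_{ηe}. -/
theorem exists_mem_cylinder_snoc {η : E.FinPath} {μ : E.Boundary} (hμ : μ ∈ E.cylinder η)
    (hfin : {e | E.r e = η.source}.Finite) (hne : {e | E.r e = η.source}.Nonempty) :
    ∃ e : {e // E.r e = η.source}, μ ∈ E.cylinder (η.snoc e.1 e.2) := by
  rcases η with ⟨v, l, hl⟩
  rcases μ with ⟨⟨v', l', hl'⟩ | ⟨f, hf⟩, hb⟩
  · obtain ⟨rfl, t, rfl⟩ := hμ
    cases t with
    | nil =>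
      rw [FinPath.source] at hfin hne
      simp only [IsBoundary, FinPath.source, List.append_nil] at hb
      exact absurd hb (not_or.2 ⟨Set.not_infinite.2 hfin, hne.ne_empty⟩)
    | cons e t =>
      exact ⟨⟨e, (isPath_append.1 hl').2.1⟩, rfl, t, by simp [FinPath.snoc]⟩
  · have hsrc : E.r (f l.length) = E.pathSource v l := by
      rcases List.eq_nil_or_concat l with rfl | ⟨l, e, rfl⟩
      · exact hμ.1.symm
      · have h := hμ.2 l.length (by simp)
        rw [List.concat_eq_append, pathSource_append, List.length_append, List.length_singleton, ← hf]
        exact (congrArg E.s (h.symm.trans (by simp)) : E.s (f l.length) = E.s e)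
    refine ⟨⟨f l.length, hsrc⟩, hμ.1, fun i hi => ?_⟩
    rcases Nat.lt_or_ge i l.length with h | h
    · exact (List.getElem_append_left h).trans (hμ.2 i h)
    · have hi' : i = l.length := by
        simp only [FinPath.snoc, List.length_append, List.length_singleton] at hi
        omega
      subst hi'
      simp [FinPath.snoc]

theorem isClopen_cylinder (η : E.FinPath) : IsClopen (E.cylinder η) :=
  ⟨⟨TopologicalSpace.isOpen_generateFrom_of_mem (Or.inr ⟨η, rfl⟩)⟩,
    TopologicalSpace.isOpen_generateFrom_of_mem (Or.inl ⟨η, rfl⟩)⟩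

theorem cylinder_subset_of_isInitial {η ν : E.FinPath} (h : E.IsInitial η (Sum.inl ν)) :
    E.cylinder ν ⊆ E.cylinder η := fun _ hμ => h.trans hμ

/-- For an ultrafilter containing D_η, the ν whose cylinders belong to it form a chain: two
cylinders that meet have comparable paths, and a finite union in an ultrafilter has a member in it.
The boundary path of this chain is the limit, which need only be checked on the subbasis. -/
theorem isCompact_cylinder (η : E.FinPath) : IsCompact (E.cylinder η) := by
  rw [isCompact_iff_ultrafilter_le_nhds]
  intro f hf
  have hη : E.cylinder η ∈ f := le_principal_iff.1 hf
  obtain ⟨μ, hμ⟩ := exists_boundary_of_chain {ν : E.FinPath | E.cylinder ν ∈ f} ⟨η, hη⟩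
    (fun ν ν' h h' => mem_of_superset h' (cylinder_subset_of_isInitial h))
    (fun ν h ν' h' => by
      obtain ⟨μ, h1, h2⟩ := f.nonempty_of_mem (inter_mem h h')
      exact h1.comparable h2)
    (fun ν h hfin hne => by
      have : Finite {e // E.r e = ν.source} := hfin
      have hU : (⋃ e ∈ (Set.univ : Set {e // E.r e = ν.source}),
          E.cylinder (ν.snoc e.1 e.2)) ∈ f := by
        refine mem_of_superset h fun μ hμ => ?_
        simpa using exists_mem_cylinder_snoc hμ hfin hne
      obtain ⟨e, -, he⟩ := (Ultrafilter.finite_biUnion_mem_iff Set.finite_univ).1 hU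
      exact ⟨e.1, e.2, he⟩)
  refine ⟨μ, (hμ η).2 hη, ?_⟩
  rw [TopologicalSpace.nhds_generateFrom]
  refine le_iInf₂ fun s hs => le_principal_iff.2 ?_
  obtain ⟨hs, ⟨ν, rfl⟩ | ⟨ν, rfl⟩⟩ := hs
  · exact (hμ ν).1 hs
  · exact Ultrafilter.compl_mem_iff_notMem.2 fun h => hs ((hμ ν).2 h)

/-- The characteristic function of a cylinder. -/
noncomputable def cylFun (η : E.FinPath) : C₀(E.Boundary, ℂ) where
  toFun := (E.cylinder η).indicator 1
  continuous_toFun := (continuous_one (M := ℂ)).indicator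
    fun a ha => absurd ha (by rw [(isClopen_cylinder η).frontier_eq]; exact Set.notMem_empty a)
  zero_at_infty' := by
    refine tendsto_const_nhds.congr' ?_
    filter_upwards [(isCompact_cylinder η).compl_mem_cocompact] with μ hμ
    exact (Set.indicator_of_notMem hμ _).symm

theorem coe_cylFun (η : E.FinPath) : (cylFun η : E.Boundary → ℂ) = (E.cylinder η).indicator 1 :=
  rfl

/-- A version of the Stone–Weierstrass theorem: the characteristic functions of the cylinders
generate `C₀(∂E)`. -/
theorem eq_top_of_forall_cylFun_mem (B : NonUnitalSubalgebra ℂ C₀(E.Boundary, ℂ))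
    (hB : IsClosed (B : Set C₀(E.Boundary, ℂ))) (hcyl : ∀ η, cylFun η ∈ B) (f : C₀(E.Boundary, ℂ)) :
    f ∈ B := by
  -- Sets whose indicator lies in B. Indicators are idempotent and real, so algebra operations turn
  -- into set operations and closure of B under conjugation is not needed.
  let R : Set (Set E.Boundary) := {U | ∃ g ∈ B, (g : E.Boundary → ℂ) = U.indicator 1}
  have hinter : ∀ U ∈ R, ∀ U' ∈ R, U ∩ U' ∈ R := by
    rintro U ⟨g, hg, hgU⟩ U' ⟨g', hg', hgU'⟩
    refine ⟨g * g', B.mul_mem hg hg', ?_⟩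
    rw [ZeroAtInftyContinuousMap.coe_mul, hgU, hgU', Set.inter_indicator_one]
  have hbasis : ∀ O : Set E.Boundary, IsOpen O → ∀ μ ∈ O, ∃ U ∈ R, μ ∈ U ∧ U ⊆ O := by
    intro O hO
    have hv : ∀ μ : E.Boundary, μ ∈ E.cylinder (.vertex E μ.range) := fun μ =>
      mem_cylinder_vertex.2 rfl
    induction hO with
    | basic s hs =>
      intro μ hμ
      rcases hs with ⟨ν, rfl⟩ | ⟨ν, rfl⟩
      · exact ⟨_, ⟨_, hcyl ν, rfl⟩, hμ, subset_rfl⟩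
      -- The complement of a cylinder need not be compact, so it is cut down to D_v with v the range
      -- of the given path.
      · refine ⟨E.cylinder (.vertex E μ.range) \ E.cylinder ν,
          ⟨cylFun (.vertex E μ.range) - cylFun (.vertex E μ.range) * cylFun ν,
            B.sub_mem (hcyl _) (B.mul_mem (hcyl _) (hcyl _)), ?_⟩, ⟨hv μ, hμ⟩, fun _ h => h.2⟩
        ext μ'
        by_cases h1 : μ' ∈ E.cylinder (.vertex E μ.range) <;>
          by_cases h2 : μ' ∈ E.cylinder ν <;> simp [coe_cylFun, h1, h2]
    | univ => exact fun μ _ => ⟨_, ⟨_, hcyl _, rfl⟩, hv μ, Set.subset_univ _⟩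
    | inter s t _ _ hs ht =>
      intro μ hμ
      obtain ⟨U, hU, h1, h2⟩ := hs μ hμ.1
      obtain ⟨U', hU', h1', h2'⟩ := ht μ hμ.2
      exact ⟨U ∩ U', hinter U hU U' hU', ⟨h1, h1'⟩, Set.inter_subset_inter h2 h2'⟩
    | sUnion S _ hS =>
      rintro μ ⟨s, hs, hμ⟩
      obtain ⟨U, hU, h1, h2⟩ := hS s hs μ hμ
      exact ⟨U, hU, h1, h2.trans (Set.subset_sUnion_of_mem hs)⟩
  refine hB.closure_subset (Metric.mem_closure_iff.2 fun ε hε => ?_)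
  -- Compact induction, carrying a set U of R together with an approximant g supported in U. If k is
  -- the indicator of U, two approximants are glued as g + (1 - k) g', so errors do not add up.
  have hcov : ∀ K : Set E.Boundary, IsCompact K → ∃ U ∈ R, K ⊆ U ∧ ∃ g ∈ B,
      (∀ μ ∈ U, ‖f μ - g μ‖ ≤ ε / 2) ∧ ∀ μ ∉ U, g μ = 0 := by
    intro K hK
    refine hK.induction_on (p := fun K => ∃ U ∈ R, K ⊆ U ∧ ∃ g ∈ B,
      (∀ μ ∈ U, ‖f μ - g μ‖ ≤ ε / 2) ∧ ∀ μ ∉ U, g μ = 0)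
      ⟨∅, ⟨0, B.zero_mem, by ext; simp⟩, subset_rfl, 0, B.zero_mem, by simp⟩ ?_ ?_ ?_
    · rintro s t hst ⟨U, hU, h, h'⟩
      exact ⟨U, hU, hst.trans h, h'⟩
    · rintro s t ⟨U, ⟨k, hk, hkU⟩, h, g, hg, h1, h2⟩ ⟨U', ⟨k', hk', hkU'⟩, h', g', hg', h1', h2'⟩
      refine ⟨U ∪ U', ⟨k + k' - k * k', B.sub_mem (B.add_mem hk hk') (B.mul_mem hk hk'), ?_⟩,
        Set.union_subset_union h h', g + g' - k * g',
        B.sub_mem (B.add_mem hg hg') (B.mul_mem hk hg'), fun μ hμ => ?_, fun μ hμ => ?_⟩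
      · ext μ
        by_cases hU : μ ∈ U <;> by_cases hU' : μ ∈ U' <;> simp [hkU, hkU', hU, hU']
      · by_cases hU : μ ∈ U
        · simpa [hkU, hU] using h1 μ hU
        · simpa [hkU, hU, h2 μ hU] using h1' μ (hμ.resolve_left hU)
      · rw [Set.mem_union, not_or] at hμ
        simp [h2 μ hμ.1, h2' μ hμ.2, hkU, hμ.1]
    · intro μ _
      obtain ⟨U, ⟨k, hk, hkU⟩, hμU, hUO⟩ := hbasis (f ⁻¹' Metric.ball (f μ) (ε / 2))
        (Metric.isOpen_ball.preimage f.continuous) μ (Metric.mem_ball_self (half_pos hε))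
      refine ⟨U, mem_nhdsWithin_of_mem_nhds ?_, U, ⟨k, hk, hkU⟩, subset_rfl, f μ • k,
        B.smul_mem _ hk, fun μ' hμ' => ?_, fun μ' hμ' => by simp [hkU, hμ']⟩
      -- U is open because its indicator k is continuous.
      · have hUk : U = k ⁻¹' Metric.ball 1 1 := by
          ext μ'
          by_cases h : μ' ∈ U <;> simp [hkU, h]
        rw [hUk]
        exact (Metric.isOpen_ball.preimage k.continuous).mem_nhds (hUk ▸ hμU)
      · have := hUO hμ'
        simp only [Set.mem_preimage, Metric.mem_ball, dist_eq_norm] at this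
        simpa [hkU, hμ'] using this.le
  obtain ⟨t, ht, htf⟩ := mem_cocompact.1
    (f.zero_at_infty'.eventually (Metric.ball_mem_nhds 0 (half_pos hε)))
  obtain ⟨U, -, htU, g, hg, h1, h2⟩ := hcov t ht
  refine ⟨g, hg, ?_⟩
  rw [← ZeroAtInftyContinuousMap.dist_toBCF_eq_dist]
  refine ((BoundedContinuousFunction.dist_le (half_pos hε).le).2 fun μ => ?_).trans_lt
    (half_lt_self hε)
  change dist (f μ) (g μ) ≤ ε / 2
  rw [dist_eq_norm]
  by_cases hμ : μ ∈ U
  · exact h1 μ hμ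
  · have := htf fun h => hμ (htU h)
    simp only [Set.mem_ofPred_eq, dist_zero_right] at this
    simpa [h2 μ hμ] using le_of_lt this

end DirGraph

namespace DirGraph

variable {V : Type u} {Edge : Type v} {E : DirGraph V Edge}

/-! ### Calculations in a Cuntz–Krieger family -/

namespace CKFamily

variable {B : Type w} [NonUnitalCStarAlgebra B] (F : E.CKFamily B)

theorem star_p (v : V) : star (F.p v) = F.p v := (F.isStarProjection_p v).isSelfAdjoint

theorem p_mul_self (v : V) : F.p v * F.p v = F.p v := (F.isStarProjection_p v).isIdempotentElem

theorem s_mul_star_s_mul_s (e : Edge) : F.s e * star (F.s e) * F.s e = F.s e := by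
  rw [mul_assoc, F.star_s_mul_s, F.s_mul_p]

theorem star_s_mul_s_mul_star_s (e : Edge) : star (F.s e) * (F.s e * star (F.s e)) =
    star (F.s e) := by
  simpa [mul_assoc] using congrArg star (F.s_mul_star_s_mul_s e)

theorem p_mul_s (e : Edge) : F.p (E.r e) * F.s e = F.s e := by
  conv_lhs => rw [← F.s_mul_star_s_mul_s e]
  rw [← mul_assoc, F.p_mul_range, F.s_mul_star_s_mul_s]

theorem p_mul_s_of_ne {v : V} {e : Edge} (h : E.r e ≠ v) : F.p v * F.s e = 0 := by
  rw [← F.p_mul_s, ← mul_assoc, F.p_mul_p _ _ h.symm, zero_mul]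

theorem s_mul_p_of_ne {v : V} {e : Edge} (h : E.s e ≠ v) : F.s e * F.p v = 0 := by
  rw [← F.s_mul_p, mul_assoc, F.p_mul_p _ _ h, mul_zero]

theorem star_s_mul_s_of_ne {e f : Edge} (h : e ≠ f) : star (F.s e) * F.s f = 0 := by
  rw [← F.star_s_mul_s_mul_star_s e, ← F.s_mul_star_s_mul_s f, mul_assoc,
    ← mul_assoc (F.s e * star (F.s e)), F.range_mul_range e f h, zero_mul, mul_zero]

theorem p_mul_listElem {v : V} {l : List Edge} (h : E.IsPath v l) :
    F.p v * F.listElem v l = F.listElem v l := by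
  cases l with
  | nil => exact F.p_mul_self v
  | cons e l =>
    obtain ⟨rfl, -⟩ := h
    rw [listElem, ← mul_assoc, F.p_mul_s]

theorem listElem_mul_p {v : V} {l : List Edge} :
    F.listElem v l * F.p (E.pathSource v l) = F.listElem v l := by
  induction l generalizing v with
  | nil => exact F.p_mul_self v
  | cons e l ih => rw [listElem, pathSource, mul_assoc, ih]

theorem star_listElem_mul_self {v : V} {l : List Edge} (h : E.IsPath v l) :
    star (F.listElem v l) * F.listElem v l = F.p (E.pathSource v l) := by
  induction l generalizing v with
  | nil => rw [listElem, F.star_p, F.p_mul_self]; rfl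
  | cons e l ih =>
    rw [listElem, star_mul, mul_assoc, ← mul_assoc (star (F.s e)), F.star_s_mul_s,
      F.p_mul_listElem h.2, ih h.2, pathSource]

theorem listElem_append_singleton {v : V} {l : List Edge} {e : Edge}
    (h : E.r e = E.pathSource v l) : F.listElem v (l ++ [e]) = F.listElem v l * F.s e := by
  induction l generalizing v with
  | nil =>
    obtain rfl : E.r e = v := h
    simp [listElem, F.s_mul_p, F.p_mul_s]
  | cons f l ih => rw [List.cons_append, listElem, ih h, listElem, mul_assoc]

/-- The projection `s_μ s_μ⋆`. -/
def rangeProj (η : E.FinPath) : B := F.pathElem η * star (F.pathElem η)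

theorem isStarProjection_rangeProj (η : E.FinPath) : IsStarProjection (F.rangeProj η) := by
  refine ⟨?_, by simp [IsSelfAdjoint, rangeProj]⟩
  rw [IsIdempotentElem, rangeProj, mul_assoc, ← mul_assoc (star _), pathElem,
    F.star_listElem_mul_self η.isPath, ← mul_assoc, F.listElem_mul_p]

theorem rangeProj_vertex (v : V) : F.rangeProj (.vertex E v) = F.p v := by
  simp [rangeProj, pathElem, FinPath.vertex, listElem, F.star_p, F.p_mul_self]

theorem rangeProj_cons (e : Edge) (η : E.FinPath) (h : E.s e = η.range) :
    F.rangeProj (η.cons e h) = F.s e * F.rangeProj η * star (F.s e) := by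
  simp [rangeProj, pathElem, FinPath.cons, listElem, h, mul_assoc]

theorem p_mul_rangeProj (η : E.FinPath) : F.p η.range * F.rangeProj η = F.rangeProj η := by
  rw [rangeProj, ← mul_assoc, pathElem, F.p_mul_listElem η.isPath]

theorem rangeProj_mul_p (η : E.FinPath) : F.rangeProj η * F.p η.range = F.rangeProj η := by
  simpa [F.star_p, (F.isStarProjection_rangeProj η).isSelfAdjoint.star_eq] using
    congrArg star (F.p_mul_rangeProj η)

/-- Every finite path is a vertex or begins with an edge. -/
theorem _root_.DirGraph.FinPath.eq_vertex_or_cons (η : E.FinPath) :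
    η = .vertex E η.range ∨ ∃ e ν, ∃ h : E.s e = FinPath.range ν, η = ν.cons e h := by
  rcases η with ⟨v, l, hl⟩
  cases l with
  | nil => exact Or.inl rfl
  | cons e l =>
    obtain ⟨rfl, h⟩ := hl
    exact Or.inr ⟨e, ⟨E.s e, l, h⟩, rfl, rfl⟩

/-- Induction on finite paths, extending them at their range. -/
theorem _root_.DirGraph.FinPath.induction {P : E.FinPath → Prop} (hv : ∀ v, P (.vertex E v))
    (hc : ∀ e ν (h : E.s e = FinPath.range ν), P ν → P (ν.cons e h)) (η : E.FinPath) : P η := by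
  rcases η with ⟨v, l, hl⟩
  induction l generalizing v with
  | nil => exact hv v
  | cons e l ih =>
    obtain ⟨rfl, h⟩ := hl
    exact hc e ⟨E.s e, l, h⟩ rfl (ih _ h)

theorem rangeProj_cons_mul_rangeProj_cons (e : Edge) (η ν : E.FinPath) (h : E.s e = η.range)
    (h' : E.s e = ν.range) : F.rangeProj (η.cons e h) * F.rangeProj (ν.cons e h') =
      F.s e * (F.rangeProj η * F.rangeProj ν) * star (F.s e) := by
  have h1 : star (F.s e) * (F.s e * (F.rangeProj ν * star (F.s e))) =
      F.rangeProj ν * star (F.s e) := by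
    rw [← mul_assoc, F.star_s_mul_s, h', ← mul_assoc, F.p_mul_rangeProj]
  simp only [rangeProj_cons, mul_assoc, h1]

theorem rangeProj_cons_mul_rangeProj_cons_of_ne {e f : Edge} (hef : e ≠ f) (η ν : E.FinPath)
    (h : E.s e = η.range) (h' : E.s f = ν.range) :
    F.rangeProj (η.cons e h) * F.rangeProj (ν.cons f h') = 0 := by
  rw [rangeProj_cons, rangeProj_cons, mul_assoc (F.s f), ← mul_assoc, mul_assoc _ (star (F.s e)),
    F.star_s_mul_s_of_ne hef, mul_zero, zero_mul]

theorem rangeProj_mul_rangeProj_of_isInitial {η ν : E.FinPath}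
    (h : E.IsInitial η (Sum.inl ν)) : F.rangeProj η * F.rangeProj ν = F.rangeProj ν := by
  induction η using FinPath.induction generalizing ν with
  | hv v =>
    obtain rfl : v = ν.range := h.1
    rw [rangeProj_vertex, p_mul_rangeProj]
  | hc e η hη ih =>
    rcases ν.eq_vertex_or_cons with hν | ⟨f, ν, hν, rfl⟩
    · have := h.2
      rw [hν] at this
      simp [FinPath.cons, FinPath.vertex] at this
    · obtain ⟨rfl, h2⟩ := List.cons_prefix_cons.1 h.2
      rw [rangeProj_cons_mul_rangeProj_cons, ih ⟨hη.symm.trans hν, h2⟩, rangeProj_cons]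

theorem rangeProj_mul_rangeProj_eq_zero {η ν : E.FinPath} (h : ¬ E.IsInitial η (Sum.inl ν))
    (h' : ¬ E.IsInitial ν (Sum.inl η)) : F.rangeProj η * F.rangeProj ν = 0 := by
  induction η using FinPath.induction generalizing ν with
  | hv v =>
    have hv : v ≠ ν.range := fun hv => h ⟨hv, List.nil_prefix⟩
    rw [rangeProj_vertex, ← p_mul_rangeProj, ← mul_assoc, F.p_mul_p _ _ hv, zero_mul]
  | hc e η hη ih =>
    rcases ν.eq_vertex_or_cons with hν | ⟨f, ν, hν, rfl⟩
    · have hr : E.r e ≠ ν.range := fun hr => h' (by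
        rw [hν]
        exact ⟨hr.symm, List.nil_prefix⟩)
      rw [hν, rangeProj_vertex, ← F.rangeProj_mul_p, mul_assoc]
      exact (congrArg _ (F.p_mul_p _ _ hr)).trans (mul_zero _)
    · by_cases hef : e = f
      · subst hef
        rw [rangeProj_cons_mul_rangeProj_cons, ih, mul_zero, zero_mul]
        · exact fun hi => h ⟨rfl, List.cons_prefix_cons.2 ⟨rfl, hi.2⟩⟩
        · exact fun hi => h' ⟨rfl, List.cons_prefix_cons.2 ⟨rfl, hi.2⟩⟩
      · exact F.rangeProj_cons_mul_rangeProj_cons_of_ne hef _ _ _ _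

theorem rangeProj_snoc (η : E.FinPath) (e : Edge) (h : E.r e = η.source) :
    F.rangeProj (η.snoc e h) =
      F.pathElem η * (F.s e * star (F.s e)) * star (F.pathElem η) := by
  simp only [rangeProj, pathElem, FinPath.snoc]
  rw [F.listElem_append_singleton h, star_mul]
  simp only [mul_assoc]

/-- The Cuntz–Krieger relation at the source of η, conjugated by s_η. -/
theorem rangeProj_eq_sum (η : E.FinPath) [Fintype {e // E.r e = η.source}]
    (hne : {e | E.r e = η.source}.Nonempty) :
    F.rangeProj η = ∑ e : {e // E.r e = η.source}, F.rangeProj (η.snoc e.1 e.2) := by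
  have hfin : {e | E.r e = η.source}.Finite := Finite.of_fintype {e // E.r e = η.source}
  have h : F.p η.source = ∑ e : {e // E.r e = η.source}, F.s e * star (F.s e) := by
    rw [F.p_eq_sum _ hfin hne]
    exact (Finset.sum_subtype _ (by simp) _)
  simp only [rangeProj_snoc]
  rw [← Finset.sum_mul, ← Finset.mul_sum, ← h, rangeProj]
  congr 1
  exact F.listElem_mul_p.symm

theorem star_s_mul_rangeProj_cons_mul_s (e : Edge) (η : E.FinPath) (h : E.s e = η.range) :
    star (F.s e) * F.rangeProj (η.cons e h) * F.s e = F.rangeProj η := by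
  rw [rangeProj_cons, mul_assoc (F.s e), ← mul_assoc, F.star_s_mul_s, mul_assoc, mul_assoc,
    F.star_s_mul_s, h, rangeProj_mul_p, p_mul_rangeProj]

end CKFamily

end DirGraph

/-! ### Operators on `ℓ²` given by partial bijections and by multiplication -/

section PEquivOperators

variable {X : Type u}

/-- The Hilbert space `ℓ²(X)`. -/
abbrev EllTwo (X : Type u) : Type u := lp (fun _ : X => ℂ) 2

/-- Only the domain of σ contributes, and σ is injective there, so the sum is a subsum of that of k.
This makes composition with σ contractive on ℓ². -/
theorem summable_and_tsum_le_of_pequiv (σ : X ≃. X) {k : X → ℝ} (hk0 : ∀ x, 0 ≤ k x)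
    (hk : Summable k) :
    Summable (fun x => (σ x).elim 0 k) ∧ ∑' x, (σ x).elim 0 k ≤ ∑' x, k x := by
  let g : {x // (σ x).isSome} → X := fun x => (σ x).get x.2
  have hg : Function.Injective g := fun x y h => Subtype.ext <|
    σ.inj (b := g y) ((Option.get_mem x.2 : g x ∈ σ x).trans (congrArg some h))
      (Option.get_mem y.2)
  have hcomp : (fun x => (σ x).elim 0 k) ∘ (Subtype.val : {x // (σ x).isSome} → X) = k ∘ g := by
    funext x
    obtain ⟨y, hy⟩ := Option.isSome_iff_exists.1 x.2
    simp [g, hy]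
  have hsupp : ∀ x ∉ Set.range (Subtype.val : {x // (σ x).isSome} → X),
      (σ x).elim 0 k = 0 := by
    intro x hx
    have : σ x = none := by simpa using hx
    simp [this]
  have hs : Summable (k ∘ g) := hk.comp_injective hg
  refine ⟨(Subtype.val_injective.summable_iff hsupp).1 (hcomp ▸ hs), ?_⟩
  rw [← Subtype.val_injective.tsum_eq (f := fun x => (σ x).elim 0 k) fun x hx =>
    not_imp_comm.1 (hsupp x) hx]
  exact (congrArg tsum hcomp).trans_le (tsum_comp_le_tsum_of_inj hk hk0 hg)

theorem EllTwo.summable_sq (f : EllTwo X) : Summable fun x => ‖f x‖ ^ 2 := by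
  simpa using (lp.memℓp f).summable (by simp)

theorem EllTwo.norm_sq (f : EllTwo X) : ‖f‖ ^ 2 = ∑' x, ‖f x‖ ^ 2 := by
  simpa using lp.norm_rpow_eq_tsum (p := 2) (by simp) f

theorem sq_norm_elim (σ : X ≃. X) (f : X → ℂ) (x : X) :
    ‖(σ x).elim 0 f‖ ^ 2 = (σ x).elim 0 fun y => ‖f y‖ ^ 2 := by
  cases σ x <;> simp

/-- The partial isometry of `ℓ²(X)` given by a partial bijection of `X`. -/
noncomputable def pequivOp (σ : X ≃. X) : EllTwo X →L[ℂ] EllTwo X :=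
  LinearMap.mkContinuous
    { toFun := fun f => ⟨fun x => (σ x).elim 0 f, memℓp_gen (by
        simpa [sq_norm_elim] using
          (summable_and_tsum_le_of_pequiv σ (fun x => by positivity) f.summable_sq).1)⟩
      map_add' := fun f g => lp.ext <| funext fun x => by
        change (σ x).elim 0 (⇑(f + g)) = (σ x).elim 0 f + (σ x).elim 0 g
        cases σ x
        · exact (add_zero 0).symm
        · rfl
      map_smul' := fun c f => lp.ext <| funext fun x => by
        change (σ x).elim 0 (⇑(c • f)) = c • (σ x).elim 0 f
        cases σ x
        · exact (smul_zero c).symm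
        · rfl } 1 fun f => by
    rw [one_mul]
    refine le_of_sq_le_sq ?_ (norm_nonneg _)
    rw [EllTwo.norm_sq, EllTwo.norm_sq]
    simpa [sq_norm_elim] using
      (summable_and_tsum_le_of_pequiv σ (fun x => by positivity) f.summable_sq).2

theorem pequivOp_apply (σ : X ≃. X) (f : EllTwo X) (x : X) :
    pequivOp σ f x = (σ x).elim 0 f := rfl

theorem pequivOp_mul (σ τ : X ≃. X) : pequivOp σ * pequivOp τ = pequivOp (σ.trans τ) := by
  ext f x
  change (σ x).elim 0 (fun y => (τ y).elim 0 f) = ((σ x).bind τ).elim 0 f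
  cases σ x <;> rfl

theorem star_pequivOp (σ : X ≃. X) : star (pequivOp σ) = pequivOp σ.symm := by
  classical
  rw [ContinuousLinearMap.star_eq_adjoint]
  ext f x
  have h : inner ℂ (lp.single 2 x (1 : ℂ) : EllTwo X) ((pequivOp σ).adjoint f) =
      ((pequivOp σ).adjoint f) x := by simp [lp.inner_single_left]
  rw [← h, ContinuousLinearMap.adjoint_inner_right, pequivOp_apply]
  -- The operator takes δ_x to δ_y when σ y = x, and to 0 when x is not a value of σ.
  have hx : pequivOp σ (lp.single 2 x (1 : ℂ)) = (σ.symm x).elim 0 fun y => lp.single 2 y (1 : ℂ) := by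
    ext z
    rw [pequivOp_apply]
    cases hz : σ z with
    | none =>
      cases hx : σ.symm x with
      | none => rfl
      | some y =>
        have hy : σ y = some x := σ.eq_some_iff.1 hx
        have : z ≠ y := by rintro rfl; simp [hz] at hy
        simp [this]
    | some w =>
      have hzw := σ.eq_some_iff.2 hz
      by_cases hw : w = x
      · subst hw
        simp [hzw]
      · cases hx : σ.symm x with
        | none => simp [hw]
        | some y =>
          have : z ≠ y := by
            rintro rfl
            have := σ.eq_some_iff.1 hx
            rw [hz] at this
            exact hw (Option.some.inj this)
          simp [hw, this]
  rw [hx]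
  cases σ.symm x <;> simp [lp.inner_single_left]

variable [TopologicalSpace X]

theorem ZeroAtInftyContinuousMap.norm_apply_le (g : C₀(X, ℂ)) (x : X) : ‖g x‖ ≤ ‖g‖ :=
  g.toBCF.norm_coe_le_norm x

theorem memℓp_mul (g : C₀(X, ℂ)) (f : EllTwo X) : Memℓp (fun x => g x * f x) 2 :=
  ((lp.memℓp f).const_smul (‖g‖ : ℂ)).mono' fun x => by
    simpa using mul_le_mul_of_nonneg_right (g.norm_apply_le x) (norm_nonneg (f x))

/-- Functions vanishing at infinity act on `ℓ²` by multiplication. -/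
noncomputable def mulOp (X : Type u) [TopologicalSpace X] :
    C₀(X, ℂ) →⋆ₙₐ[ℂ] (EllTwo X →L[ℂ] EllTwo X) where
  toFun g := LinearMap.mkContinuous
    { toFun := fun f => ⟨fun x => g x * f x, memℓp_mul g f⟩
      map_add' := fun f f' => lp.ext <| funext fun x => mul_add _ _ _
      map_smul' := fun c f => lp.ext <| funext fun x => mul_left_comm _ _ _ } ‖g‖ fun f => by
    have h : ‖(‖g‖ : ℂ) • f‖ = ‖g‖ * ‖f‖ := by rw [norm_smul]; simp
    rw [← h]
    exact lp.norm_mono (by simp) fun x => by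
      simpa [lp.coeFn_smul, -Complex.coe_smul] using mul_le_mul_of_nonneg_right (g.norm_apply_le x) (norm_nonneg (f x))
  map_smul' c g := by ext f x; exact mul_assoc _ _ _
  map_zero' := by ext f x; exact zero_mul _
  map_add' g g' := by ext f x; exact add_mul _ _ _
  map_mul' g g' := by ext f x; exact mul_assoc _ _ _
  map_star' g := by
    rw [ContinuousLinearMap.star_eq_adjoint, ContinuousLinearMap.eq_adjoint_iff]
    intro f f'
    rw [lp.inner_eq_tsum, lp.inner_eq_tsum]
    refine tsum_congr fun x => ?_
    change inner ℂ (star (g x) * f x) (f' x) = inner ℂ (f x) (g x * f' x)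
    simp [mul_comm, mul_assoc]

theorem mulOp_apply (g : C₀(X, ℂ)) (f : EllTwo X) (x : X) : mulOp X g f x = g x * f x := rfl

/-- The value g x is recovered as the (x, x) matrix coefficient. -/
theorem mulOp_injective : Function.Injective (mulOp X) := by
  classical
  intro g g' h
  ext x
  have := congrArg (fun T : EllTwo X →L[ℂ] EllTwo X => T (lp.single 2 x (1 : ℂ)) x) h
  simpa [mulOp_apply] using this

end PEquivOperators

namespace DirGraph

variable {V : Type u} {Edge : Type v} {E : DirGraph V Edge}

/-! ### The boundary representation -/

/-- The path of length one given by an edge. -/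
def FinPath.edge (E : DirGraph V Edge) (e : Edge) : E.FinPath :=
  (FinPath.vertex E (E.s e)).cons e rfl

theorem mem_cylinder_edge {e : Edge} {μ : E.Boundary} :
    μ ∈ E.cylinder (.edge E e) ↔ ∃ μ' : E.Boundary, ∃ h : E.s e = μ'.range, μ = μ'.cons e h := by
  constructor
  · exact exists_cons_of_mem_cylinder
  · rintro ⟨μ', h, rfl⟩
    exact mem_cylinder_cons.2 (mem_cylinder_vertex.2 h.symm)

theorem cylFun_apply_of_mem {η : E.FinPath} {μ : E.Boundary} (h : μ ∈ E.cylinder η) :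
    cylFun η μ = 1 := Set.indicator_of_mem h _

theorem cylFun_apply_of_notMem {η : E.FinPath} {μ : E.Boundary} (h : μ ∉ E.cylinder η) :
    cylFun η μ = 0 := Set.indicator_of_notMem h _

theorem cylFun_mul_self (η : E.FinPath) : cylFun η * cylFun η = cylFun η := by
  ext μ
  by_cases h : μ ∈ E.cylinder η <;>
    simp [cylFun_apply_of_mem, cylFun_apply_of_notMem, h]

theorem star_cylFun (η : E.FinPath) : star (cylFun η) = cylFun η := by
  ext μ
  by_cases h : μ ∈ E.cylinder η <;>
    simp [cylFun_apply_of_mem, cylFun_apply_of_notMem, h]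

theorem cylFun_mul_eq_zero {η ν : E.FinPath} (h : ∀ μ ∈ E.cylinder η, μ ∉ E.cylinder ν) :
    cylFun η * cylFun ν = 0 := by
  ext μ
  by_cases hμ : μ ∈ E.cylinder η
  · simp [cylFun_apply_of_notMem (h μ hμ)]
  · simp [cylFun_apply_of_notMem hμ]

theorem notMem_cylinder_edge {e f : Edge} (h : e ≠ f) (μ : E.Boundary)
    (hμ : μ ∈ E.cylinder (.edge E e)) : μ ∉ E.cylinder (.edge E f) := by
  obtain ⟨μ', h', rfl⟩ := mem_cylinder_edge.1 hμ
  exact mem_cylinder_cons_of_ne h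

open scoped Classical in
/-- The partial bijection `eμ ↦ μ` of the boundary space. -/
noncomputable def edgePEquiv (E : DirGraph V Edge) (e : Edge) : E.Boundary ≃. E.Boundary where
  toFun ν := if h : ∃ μ : E.Boundary, ∃ hμ : E.s e = μ.range, ν = μ.cons e hμ then
    some h.choose else none
  invFun μ := if h : E.s e = μ.range then some (μ.cons e h) else none
  inv ν μ := by
    constructor
    · intro h
      split_ifs at h with h1
      obtain rfl : μ.cons e h1 = ν := Option.some.inj h
      have h2 : ∃ μ' : E.Boundary, ∃ hμ' : E.s e = μ'.range, μ.cons e h1 = μ'.cons e hμ' :=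
        ⟨μ, h1, rfl⟩
      rw [dif_pos h2]
      exact congrArg some (Boundary.cons_injective h2.choose_spec.choose_spec).symm
    · intro h
      split_ifs at h with h1
      obtain rfl : h1.choose = μ := Option.some.inj h
      obtain ⟨h2, h3⟩ := h1.choose_spec
      rw [dif_pos h2]
      exact congrArg some h3.symm

theorem edgePEquiv_symm_apply (e : Edge) (μ : E.Boundary) (h : E.s e = μ.range) :
    (E.edgePEquiv e).symm μ = some (μ.cons e h) := dif_pos h

theorem edgePEquiv_symm_apply_of_ne (e : Edge) (μ : E.Boundary) (h : E.s e ≠ μ.range) :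
    (E.edgePEquiv e).symm μ = none := dif_neg h

theorem edgePEquiv_cons (e : Edge) (μ : E.Boundary) (h : E.s e = μ.range) :
    E.edgePEquiv e (μ.cons e h) = some μ :=
  (E.edgePEquiv e).eq_some_iff.1 (edgePEquiv_symm_apply e μ h)

theorem edgePEquiv_eq_none (e : Edge) (μ : E.Boundary) (h : μ ∉ E.cylinder (.edge E e)) :
    E.edgePEquiv e μ = none := dif_neg fun h' => h (mem_cylinder_edge.2 h')

/-- Conjugation by s_e moves χ_{D_η} to χ_{D_{eη}}; this is the inductive step that identifies every
range projection with multiplication by an indicator. -/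
theorem pequivOp_edge_mul_mulOp_mul (e : Edge) (η : E.FinPath) (h : E.s e = η.range) :
    pequivOp (E.edgePEquiv e) * mulOp E.Boundary (cylFun η) * star (pequivOp (E.edgePEquiv e)) =
      mulOp E.Boundary (cylFun (η.cons e h)) := by
  rw [star_pequivOp]
  ext f ν
  change (E.edgePEquiv e ν).elim 0 (fun μ => cylFun η μ * ((E.edgePEquiv e).symm μ).elim 0 f) =
    cylFun (η.cons e h) ν * f ν
  by_cases hν : ν ∈ E.cylinder (.edge E e)
  · obtain ⟨μ, hμ, rfl⟩ := mem_cylinder_edge.1 hν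
    rw [edgePEquiv_cons, Option.elim_some, edgePEquiv_symm_apply e μ hμ, Option.elim_some]
    congr 1
    by_cases hμη : μ ∈ E.cylinder η
    · rw [cylFun_apply_of_mem hμη, cylFun_apply_of_mem (mem_cylinder_cons.2 hμη)]
    · rw [cylFun_apply_of_notMem hμη, cylFun_apply_of_notMem (mt mem_cylinder_cons.1 hμη)]
  · rw [edgePEquiv_eq_none e ν hν, Option.elim_none, cylFun_apply_of_notMem, zero_mul]
    exact fun h' => hν (mem_cylinder_edge.2 (exists_cons_of_mem_cylinder h'))

theorem star_pequivOp_edge_mul (e : Edge) :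
    star (pequivOp (E.edgePEquiv e)) * pequivOp (E.edgePEquiv e) =
      mulOp E.Boundary (cylFun (.vertex E (E.s e))) := by
  rw [star_pequivOp]
  ext f μ
  change ((E.edgePEquiv e).symm μ).elim 0 (fun μ => (E.edgePEquiv e μ).elim 0 f) =
    cylFun (.vertex E (E.s e)) μ * f μ
  by_cases h : E.s e = μ.range
  · rw [edgePEquiv_symm_apply e μ h, Option.elim_some, edgePEquiv_cons, Option.elim_some,
      cylFun_apply_of_mem (mem_cylinder_vertex.2 h.symm), one_mul]
  · rw [edgePEquiv_symm_apply_of_ne e μ h, Option.elim_none,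
      cylFun_apply_of_notMem (mt mem_cylinder_vertex.1 (Ne.symm h)), zero_mul]

theorem pequivOp_edge_mul_star (e : Edge) :
    pequivOp (E.edgePEquiv e) * star (pequivOp (E.edgePEquiv e)) =
      mulOp E.Boundary (cylFun (.edge E e)) := by
  rw [FinPath.edge, ← pequivOp_edge_mul_mulOp_mul e (.vertex E (E.s e)) rfl, ← star_pequivOp_edge_mul, mul_assoc,
    star_pequivOp, pequivOp_mul, pequivOp_mul, pequivOp_mul, pequivOp_mul]
  congr 1
  ext μ : 1
  by_cases hμ : μ ∈ E.cylinder (.edge E e)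
  · obtain ⟨μ, h, rfl⟩ := mem_cylinder_edge.1 hμ
    simp [PEquiv.trans, edgePEquiv_cons, edgePEquiv_symm_apply _ _ h]
  · simp [PEquiv.trans, edgePEquiv_eq_none _ _ hμ]

theorem cylFun_vertex_eq_sum {v : V} (hfin : {e | E.r e = v}.Finite)
    (hne : {e | E.r e = v}.Nonempty) :
    cylFun (.vertex E v) = ∑ e ∈ hfin.toFinset, cylFun (.edge E e) := by
  ext μ
  have hsum : (∑ e ∈ hfin.toFinset, cylFun (.edge E e)) μ =
      ∑ e ∈ hfin.toFinset, cylFun (.edge E e) μ := by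
    exact map_sum (⟨⟨fun g : C₀(E.Boundary, ℂ) => g μ, rfl⟩, fun _ _ => rfl⟩ :
      C₀(E.Boundary, ℂ) →+ ℂ) _ _
  rw [hsum]
  by_cases hμ : μ.range = v
  · subst hμ
    obtain ⟨e, μ', h, rfl⟩ := μ.exists_eq_cons hfin hne
    have he : μ'.cons e h ∈ E.cylinder (.edge E e) := mem_cylinder_edge.2 ⟨μ', h, rfl⟩
    rw [cylFun_apply_of_mem (mem_cylinder_vertex.2 rfl), Finset.sum_eq_single e,
      cylFun_apply_of_mem he]
    · exact fun f _ hf => cylFun_apply_of_notMem (notMem_cylinder_edge hf.symm _ he)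
    · exact fun hcon => absurd (by simp) hcon
  · rw [cylFun_apply_of_notMem (mt mem_cylinder_vertex.1 hμ)]
    refine (Finset.sum_eq_zero fun e he => cylFun_apply_of_notMem fun h => hμ ?_).symm
    rw [range_eq_of_mem_cylinder h]
    exact hfin.mem_toFinset.1 he

/-- The Cuntz–Krieger family on `ℓ²(∂E)` that shifts boundary paths. -/
noncomputable def boundaryFamily (E : DirGraph V Edge) :
    E.CKFamily (EllTwo E.Boundary →L[ℂ] EllTwo E.Boundary) where
  p v := mulOp E.Boundary (cylFun (.vertex E v))
  -- `pequivOp` acts by composition, so the partial bijection eμ ↦ μ yields δ_μ ↦ δ_{eμ}: the edge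
  -- is prepended.
  s e := pequivOp (E.edgePEquiv e)
  isStarProjection_p v := ⟨by rw [IsIdempotentElem, ← map_mul, cylFun_mul_self],
    by rw [IsSelfAdjoint, ← map_star, star_cylFun]⟩
  p_mul_p v v' h := by
    rw [← map_mul, cylFun_mul_eq_zero, map_zero]
    exact fun μ hμ hμ' => h ((mem_cylinder_vertex.1 hμ).symm.trans (mem_cylinder_vertex.1 hμ'))
  star_s_mul_s := star_pequivOp_edge_mul
  range_mul_range e f h := by
    rw [pequivOp_edge_mul_star, pequivOp_edge_mul_star, ← map_mul,
      cylFun_mul_eq_zero (notMem_cylinder_edge h), map_zero]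
  p_mul_range e := by
    rw [pequivOp_edge_mul_star, ← map_mul]
    congr 1
    ext μ
    by_cases hμ : μ ∈ E.cylinder (.edge E e)
    · have h : μ ∈ E.cylinder (.vertex E (E.r e)) :=
        mem_cylinder_vertex.2 (range_eq_of_mem_cylinder hμ)
      simp [cylFun_apply_of_mem hμ, cylFun_apply_of_mem h]
    · simp [cylFun_apply_of_notMem hμ]
  p_eq_sum v h hne := by
    rw [cylFun_vertex_eq_sum h hne, map_sum]
    simp only [pequivOp_edge_mul_star]

theorem boundaryFamily_rangeProj (η : E.FinPath) :
    E.boundaryFamily.rangeProj η = mulOp E.Boundary (cylFun η) := by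
  induction η using FinPath.induction with
  | hv v => exact E.boundaryFamily.rangeProj_vertex v
  | hc e η h ih =>
    rw [CKFamily.rangeProj_cons, ih]
    exact pequivOp_edge_mul_mulOp_mul e η h

/-- The representation of `C⋆(E)` on `ℓ²(∂E)`. -/
noncomputable def boundaryRep (E : DirGraph V Edge) :
    E.GraphCStar →⋆ₙₐ[ℂ] (EllTwo E.Boundary →L[ℂ] EllTwo E.Boundary) :=
  -- The operators on ℓ²(∂E) live in `Type (max u v)`, so this family is one of the factors of
  -- `BigProd`.
  E.evalRep ⟨_, E.boundaryFamily⟩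

theorem boundaryRep_s (e : Edge) : E.boundaryRep (E.univ.s e) = pequivOp (E.edgePEquiv e) := rfl

theorem boundaryRep_rangeProj (η : E.FinPath) :
    E.boundaryRep (E.univ.rangeProj η) = mulOp E.Boundary (cylFun η) := by
  rw [← boundaryFamily_rangeProj]
  induction η using FinPath.induction with
  | hv v => rw [CKFamily.rangeProj_vertex, CKFamily.rangeProj_vertex]; rfl
  | hc e η h ih =>
    rw [CKFamily.rangeProj_cons, CKFamily.rangeProj_cons, ← ih, map_mul, map_mul, map_star]; rfl

/-- In the boundary representation p_v is multiplication by the indicator of the nonempty set D_v.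
The resulting ‖p_v‖ = 1 makes the later norm formula exact. -/
theorem univ_p_ne_zero (v : V) : E.univ.p v ≠ 0 := by
  intro h
  have h1 := boundaryRep_rangeProj (FinPath.vertex E v)
  rw [CKFamily.rangeProj_vertex, h, map_zero] at h1
  have h2 : cylFun (.vertex E v) = 0 := mulOp_injective (h1.symm.trans (map_zero _).symm)
  obtain ⟨μ, hμ⟩ := E.exists_boundary_range_eq v
  have h3 := cylFun_apply_of_mem (mem_cylinder_vertex.2 hμ)
  rw [h2] at h3
  exact zero_ne_one h3

theorem norm_univ_p (v : V) : ‖E.univ.p v‖ = 1 := by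
  have h := CStarRing.norm_star_mul_self (x := E.univ.p v)
  rw [E.univ.star_p, E.univ.p_mul_self] at h
  have h0 : ‖E.univ.p v‖ ≠ 0 := norm_ne_zero_iff.2 (univ_p_ne_zero v)
  exact (mul_right_cancel₀ h0 ((one_mul _).trans h)).symm

end DirGraph

namespace DirGraph

variable {V : Type u} {Edge : Type v} {E : DirGraph V Edge}

/-! ### The diagonal -/

theorem isClosed_diagonal (E : DirGraph V Edge) : IsClosed (E.diagonal : Set E.GraphCStar) :=
  NonUnitalStarSubalgebra.isClosed_topologicalClosure _

/-- The induction principle for D_E: a property that cuts out a closed star subalgebra need only be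
checked on range projections. -/
theorem diagonal_le {K : NonUnitalStarSubalgebra ℂ E.GraphCStar}
    (hK : IsClosed (K : Set E.GraphCStar)) (h : ∀ η, E.univ.rangeProj η ∈ K) : E.diagonal ≤ K :=
  NonUnitalStarSubalgebra.topologicalClosure_minimal _
    (NonUnitalStarAlgebra.adjoin_le (by rintro _ ⟨η, rfl⟩; exact h η)) hK

theorem rangeProj_mem_diagonal (η : E.FinPath) : E.univ.rangeProj η ∈ E.diagonal :=
  (E.diagProj η).2

theorem coe_diagProj (η : E.FinPath) : (E.diagProj η : E.GraphCStar) = E.univ.rangeProj η := rfl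

theorem CKFamily.commute_rangeProj {B : Type w} [NonUnitalCStarAlgebra B] (F : E.CKFamily B)
    (η ν : E.FinPath) : F.rangeProj η * F.rangeProj ν = F.rangeProj ν * F.rangeProj η := by
  have hstar : ∀ η ν : E.FinPath, E.IsInitial η (Sum.inl ν) →
      F.rangeProj η * F.rangeProj ν = F.rangeProj ν * F.rangeProj η := by
    intro η ν h
    have h1 := F.rangeProj_mul_rangeProj_of_isInitial h
    have h2 := congrArg star h1
    rw [star_mul, (F.isStarProjection_rangeProj η).isSelfAdjoint.star_eq,
      (F.isStarProjection_rangeProj ν).isSelfAdjoint.star_eq] at h2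
    rw [h1, h2]
  by_cases h : E.IsInitial η (Sum.inl ν)
  · exact hstar η ν h
  · by_cases h' : E.IsInitial ν (Sum.inl η)
    · exact (hstar ν η h').symm
    · rw [F.rangeProj_mul_rangeProj_eq_zero h h', F.rangeProj_mul_rangeProj_eq_zero h' h]

theorem diagonal_le_centralizer {s : Set E.GraphCStar}
    (h : ∀ η, ∀ x ∈ s, x * E.univ.rangeProj η = E.univ.rangeProj η * x) :
    E.diagonal ≤ NonUnitalStarSubalgebra.centralizer ℂ s := by
  refine diagonal_le ?_ fun η => ?_
  · rw [NonUnitalStarSubalgebra.coe_centralizer]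
    exact Set.isClosed_centralizer _
  · rw [NonUnitalStarSubalgebra.mem_centralizer_iff]
    refine fun x hx => ⟨h η x hx, ?_⟩
    have := congrArg star (h η x hx)
    rw [star_mul, star_mul, (E.univ.isStarProjection_rangeProj η).isSelfAdjoint.star_eq] at this
    exact this.symm

/-- Two passes through the centralizer: first D_E commutes with the range projections, then with
everything that commutes with those. -/
theorem diagonal_mul_comm {x y : E.GraphCStar} (hx : x ∈ E.diagonal) (hy : y ∈ E.diagonal) :
    x * y = y * x := by
  have h1 : ∀ y ∈ E.diagonal, ∀ η, E.univ.rangeProj η * y = y * E.univ.rangeProj η := by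
    intro y hy η
    have := diagonal_le_centralizer (s := Set.range E.univ.rangeProj)
      (by rintro η _ ⟨ν, rfl⟩; exact E.univ.commute_rangeProj ν η) hy
    exact (((NonUnitalStarSubalgebra.mem_centralizer_iff ℂ).1 this) _ ⟨η, rfl⟩).1
  have := diagonal_le_centralizer (s := (E.diagonal : Set E.GraphCStar))
    (fun η y hy => (h1 y hy η).symm) hx
  exact ((((NonUnitalStarSubalgebra.mem_centralizer_iff ℂ).1 this) y hy).1).symm

/-- The diagonal is a commutative C⋆-algebra. -/
noncomputable abbrev diagonalCStarAlgebra (E : DirGraph V Edge) :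
    NonUnitalCommCStarAlgebra E.diagonal where
  toNonUnitalCStarAlgebra := NonUnitalStarSubalgebra.nonUnitalCStarAlgebra E.diagonal
    (h_closed := E.isClosed_diagonal)
  mul_comm x y := Subtype.ext (diagonal_mul_comm x.2 y.2)

attribute [local instance] diagonalCStarAlgebra

theorem diagonal_hom_ext {φ φ' : E.diagonal →⋆ₙₐ[ℂ] ℂ}
    (h : ∀ η, φ (E.diagProj η) = φ' (E.diagProj η)) : φ = φ' := by
  let K := NonUnitalStarAlgHom.equalizer φ φ'
  have hK : IsClosed (K : Set E.diagonal) :=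
    isClosed_eq (map_continuous φ) (map_continuous φ')
  -- The generators are given inside C⋆(E), so the equalizer is pushed forward there; its image
  -- stays closed because D_E is closed.
  have hle : E.diagonal ≤ K.map (NonUnitalStarSubalgebraClass.subtype E.diagonal) := by
    refine diagonal_le ?_ fun η => ⟨E.diagProj η, h η, rfl⟩
    rw [NonUnitalStarSubalgebra.coe_map]
    exact E.isClosed_diagonal.isClosedEmbedding_subtypeVal.isClosedMap _ hK
  refine NonUnitalStarAlgHom.ext fun x => ?_
  obtain ⟨y, hy, hyx⟩ := hle x.2
  obtain rfl : y = x := Subtype.ext hyx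
  exact hy

theorem diagProj_eq_sum (η : E.FinPath) [Fintype {e // E.r e = η.source}]
    (hne : {e | E.r e = η.source}.Nonempty) :
    E.diagProj η = ∑ e : {e // E.r e = η.source}, E.diagProj (η.snoc e.1 e.2) := by
  refine Subtype.ext ?_
  rw [coe_diagProj, E.univ.rangeProj_eq_sum η hne, AddSubmonoidClass.coe_finsetSum]
  rfl

/-- A nonzero character of the diagonal is the evaluation at a boundary path. -/
theorem exists_boundary_of_character (φ : E.diagonal →⋆ₙₐ[ℂ] ℂ)
    (hφ : ∃ η, φ (E.diagProj η) ≠ 0) :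
    ∃ μ : E.Boundary, ∀ η, φ (E.diagProj η) = cylFun η μ := by
  have h01 : ∀ η, φ (E.diagProj η) ≠ 0 → φ (E.diagProj η) = 1 := by
    intro η h
    have h1 : E.diagProj η * E.diagProj η = E.diagProj η :=
      Subtype.ext (E.univ.isStarProjection_rangeProj η).isIdempotentElem
    have h2 := congrArg φ h1
    rw [map_mul] at h2
    exact mul_right_cancel₀ h (h2.trans (one_mul _).symm)
  -- Range projections of initial segments absorb those of longer paths, incomparable paths have
  -- orthogonal ones, and `diagProj_eq_sum` provides the extension; φ turns these into the three
  -- conditions on a chain.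
  obtain ⟨μ, hμ⟩ := exists_boundary_of_chain {η | φ (E.diagProj η) ≠ 0} hφ
    (fun η ν h hν hη => hν (by
      have h1 : E.diagProj η * E.diagProj ν = E.diagProj ν :=
        Subtype.ext (E.univ.rangeProj_mul_rangeProj_of_isInitial h)
      rw [← h1, map_mul, hη, zero_mul]))
    (fun η hη ν hν => by
      by_contra hcon
      rw [not_or] at hcon
      have h1 : E.diagProj η * E.diagProj ν = 0 :=
        Subtype.ext (E.univ.rangeProj_mul_rangeProj_eq_zero hcon.1 hcon.2)
      have h2 := congrArg φ h1
      rw [map_mul, map_zero] at h2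
      exact (mul_ne_zero hη hν) h2)
    (fun η hη hfin hne => by
      by_contra! hcon
      have : Fintype {e // E.r e = η.source} := hfin.fintype
      refine hη ?_
      rw [diagProj_eq_sum η hne, map_sum]
      refine Finset.sum_eq_zero fun e _ => ?_
      simpa using hcon e.1 e.2)
  refine ⟨μ, fun η => ?_⟩
  by_cases h : φ (E.diagProj η) = 0
  · rw [h, cylFun_apply_of_notMem fun h' => (hμ η).1 h' h]
  · rw [h01 η h, cylFun_apply_of_mem ((hμ η).2 h)]

/-- An injective star homomorphism is isometric, so the multiplication operators form a closed
subalgebra; it contains the images of the generators of D_E. -/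
theorem exists_mulOp_eq_boundaryRep (a : E.diagonal) :
    ∃ g : C₀(E.Boundary, ℂ), mulOp E.Boundary g = E.boundaryRep a := by
  have hcl : IsClosed (NonUnitalStarAlgHom.range (mulOp E.Boundary) :
      Set (EllTwo E.Boundary →L[ℂ] EllTwo E.Boundary)) := by
    have := (NonUnitalStarAlgHom.isometry (mulOp E.Boundary)
      mulOp_injective).isClosedEmbedding.isClosed_range
    exact this
  have hle : E.diagonal ≤ (NonUnitalStarAlgHom.range (mulOp E.Boundary)).comap E.boundaryRep :=
    diagonal_le (hcl.preimage (map_continuous E.boundaryRep))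
      fun η => ⟨cylFun η, (boundaryRep_rangeProj η).symm⟩
  exact hle a.2

/-- The homomorphism `D_E → C₀(∂E)` given by the boundary representation. -/
noncomputable def diagonalHom (E : DirGraph V Edge) : E.diagonal →⋆ₙₐ[ℂ] C₀(E.Boundary, ℂ) where
  toFun a := (exists_mulOp_eq_boundaryRep a).choose
  map_smul' c a := mulOp_injective (by
    rw [(exists_mulOp_eq_boundaryRep _).choose_spec, MonoidHom.id_apply, map_smul,
      (exists_mulOp_eq_boundaryRep _).choose_spec, ← map_smul]; rfl)
  map_zero' := mulOp_injective (by
    rw [(exists_mulOp_eq_boundaryRep _).choose_spec, map_zero]; exact map_zero E.boundaryRep)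
  map_add' a b := mulOp_injective (by
    rw [(exists_mulOp_eq_boundaryRep _).choose_spec, map_add,
      (exists_mulOp_eq_boundaryRep _).choose_spec, (exists_mulOp_eq_boundaryRep _).choose_spec,
      ← map_add]; rfl)
  map_mul' a b := mulOp_injective (by
    rw [(exists_mulOp_eq_boundaryRep _).choose_spec, map_mul,
      (exists_mulOp_eq_boundaryRep _).choose_spec, (exists_mulOp_eq_boundaryRep _).choose_spec,
      ← map_mul]; rfl)
  map_star' a := mulOp_injective (by
    rw [(exists_mulOp_eq_boundaryRep _).choose_spec, map_star,
      (exists_mulOp_eq_boundaryRep _).choose_spec, ← map_star]; rfl)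

theorem mulOp_diagonalHom (a : E.diagonal) :
    mulOp E.Boundary (E.diagonalHom a) = E.boundaryRep a :=
  (exists_mulOp_eq_boundaryRep a).choose_spec

theorem diagonalHom_diagProj (η : E.FinPath) : E.diagonalHom (E.diagProj η) = cylFun η :=
  mulOp_injective ((mulOp_diagonalHom _).trans (boundaryRep_rangeProj η))

/-- Evaluation at a boundary path, as a character of the diagonal. -/
noncomputable def diagonalEval (μ : E.Boundary) : E.diagonal →⋆ₙₐ[ℂ] ℂ where
  toFun a := E.diagonalHom a μ
  map_smul' c a := by rw [map_smul]; rfl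
  map_zero' := by rw [map_zero]; rfl
  map_add' a b := by rw [map_add]; rfl
  map_mul' a b := by rw [map_mul]; rfl
  map_star' a := by rw [map_star]; rfl

/-- Every character of D_E is zero or evaluation at a boundary path, hence kills any a in the
kernel. The Gelfand transform of the unitization is isometric, so a = 0. -/
theorem diagonalHom_injective (E : DirGraph V Edge) : Function.Injective E.diagonalHom := by
  rw [injective_iff_map_eq_zero]
  intro a ha
  have hchar : ∀ φ : E.diagonal →⋆ₙₐ[ℂ] ℂ, φ a = 0 := by
    intro φ
    by_cases hφ : ∃ η, φ (E.diagProj η) ≠ 0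
    · obtain ⟨μ, hμ⟩ := exists_boundary_of_character φ hφ
      have : φ = diagonalEval μ := diagonal_hom_ext fun η => by
        rw [hμ η, ← diagonalHom_diagProj]; rfl
      rw [this]
      change E.diagonalHom a μ = 0
      rw [ha]; rfl
    · push Not at hφ
      have : φ = 0 := diagonal_hom_ext fun η => hφ η
      rw [this]; rfl
  have h0 : (a : Unitization ℂ E.diagonal) = 0 := by
    apply (gelfandTransform_isometry (Unitization ℂ E.diagonal)).injective
    ext ω
    rw [map_zero]
    exact hchar ((NonUnitalStarAlgHomClass.toNonUnitalStarAlgHom ω).comp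
      (Unitization.inrNonUnitalStarAlgHom ℂ E.diagonal))
  exact Unitization.inr_injective (h0.trans (Unitization.inr_zero ℂ).symm)

theorem diagonalHom_surjective (E : DirGraph V Edge) : Function.Surjective E.diagonalHom := by
  have hcl := (NonUnitalStarAlgHom.isometry E.diagonalHom
    E.diagonalHom_injective).isClosedEmbedding.isClosed_range
  intro f
  exact eq_top_of_forall_cylFun_mem
    (NonUnitalStarAlgHom.range E.diagonalHom).toNonUnitalSubalgebra hcl
    (fun η => ⟨E.diagProj η, diagonalHom_diagProj η⟩) f

/-- The isomorphism `D_E ≅ C₀(∂E)`. -/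
noncomputable def diagonalEquiv (E : DirGraph V Edge) : E.diagonal ≃⋆ₐ[ℂ] C₀(E.Boundary, ℂ) :=
  StarAlgEquiv.ofBijective E.diagonalHom ⟨E.diagonalHom_injective, E.diagonalHom_surjective⟩

theorem diagonalEquiv_apply (a : E.diagonal) : E.diagonalEquiv a = E.diagonalHom a := rfl

end DirGraph

namespace DirGraph

variable {V : Type u} {Edge : Type v} {E : DirGraph V Edge}

attribute [local instance] diagonalCStarAlgebra

/-! ### The transfer operator on the diagonal -/

theorem CKFamily.rangeProj_edge {B : Type w} [NonUnitalCStarAlgebra B] (F : E.CKFamily B)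
    (e : Edge) : F.rangeProj (.edge E e) = F.s e * star (F.s e) := by
  rw [FinPath.edge, F.rangeProj_cons e (.vertex E (E.s e)) rfl, F.rangeProj_vertex, F.s_mul_p]

theorem s_mul_star_mem_diagonal (e : Edge) : E.univ.s e * star (E.univ.s e) ∈ E.diagonal :=
  E.univ.rangeProj_edge e ▸ rangeProj_mem_diagonal _

/-- Write s_e = s_e s_e⋆ s_e and move the range projection past x. It follows that s_e⋆ x s_f = 0
for e ≠ f, and that x ↦ s_e⋆ x s_e is multiplicative on D_E. -/
theorem mul_s_of_mem_diagonal {x : E.GraphCStar} (hx : x ∈ E.diagonal) (e : Edge) :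
    x * E.univ.s e = E.univ.s e * star (E.univ.s e) * x * E.univ.s e := by
  conv_lhs => rw [← E.univ.s_mul_star_s_mul_s e]
  rw [← mul_assoc, diagonal_mul_comm hx (s_mul_star_mem_diagonal e)]

theorem star_s_mul_mul_s_of_ne {x : E.GraphCStar} (hx : x ∈ E.diagonal) {e f : Edge}
    (h : e ≠ f) : star (E.univ.s e) * x * E.univ.s f = 0 := by
  rw [mul_assoc, mul_s_of_mem_diagonal hx]
  simp only [← mul_assoc]
  rw [E.univ.star_s_mul_s_of_ne h]
  simp

theorem star_s_mul_rangeProj_mul_s_mem (e : Edge) (η : E.FinPath) :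
    star (E.univ.s e) * E.univ.rangeProj η * E.univ.s e ∈ E.diagonal := by
  rcases η.eq_vertex_or_cons with hη | ⟨f, ν, h, rfl⟩
  · rw [hη, E.univ.rangeProj_vertex]
    by_cases h : E.r e = η.range
    · rw [mul_assoc, ← h, E.univ.p_mul_s, E.univ.star_s_mul_s, ← E.univ.rangeProj_vertex]
      exact rangeProj_mem_diagonal _
    · rw [mul_assoc, E.univ.p_mul_s_of_ne h, mul_zero]
      exact zero_mem _
  · by_cases hef : e = f
    · subst hef
      rw [E.univ.star_s_mul_rangeProj_cons_mul_s]
      exact rangeProj_mem_diagonal _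
    · rw [E.univ.rangeProj_cons, ← mul_assoc, ← mul_assoc, E.univ.star_s_mul_s_of_ne hef]
      simp only [zero_mul]
      exact zero_mem _

theorem star_s_mul_mul_s_mem {x : E.GraphCStar} (hx : x ∈ E.diagonal) (e : Edge) :
    star (E.univ.s e) * x * E.univ.s e ∈ E.diagonal := by
  -- Membership in D_E is part of K because compression by s_e is multiplicative only there.
  let K : NonUnitalStarSubalgebra ℂ E.GraphCStar :=
    { carrier := {x | x ∈ E.diagonal ∧ star (E.univ.s e) * x * E.univ.s e ∈ E.diagonal}
      add_mem' := fun {x y} hx hy => ⟨add_mem hx.1 hy.1, by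
        rw [mul_add, add_mul]; exact add_mem hx.2 hy.2⟩
      zero_mem' := ⟨zero_mem _, by simp⟩
      mul_mem' := fun {x y} hx hy => ⟨mul_mem hx.1 hy.1, by
        have h : star (E.univ.s e) * (x * y) * E.univ.s e =
            (star (E.univ.s e) * x * E.univ.s e) * (star (E.univ.s e) * y * E.univ.s e) := by
          rw [mul_assoc, mul_assoc x, mul_s_of_mem_diagonal hy.1]
          simp only [mul_assoc]
        rw [h]
        exact mul_mem hx.2 hy.2⟩
      smul_mem' := fun c x hx => ⟨SMulMemClass.smul_mem c hx.1, by
        rw [mul_smul_comm, smul_mul_assoc]; exact SMulMemClass.smul_mem c hx.2⟩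
      star_mem' := fun {x} hx => ⟨star_mem hx.1, by
        have := star_mem hx.2
        simpa [mul_assoc] using this⟩ }
  have hK : IsClosed (K : Set E.GraphCStar) :=
    E.isClosed_diagonal.inter (E.isClosed_diagonal.preimage (by fun_prop))
  exact (diagonal_le hK (fun η => ⟨rangeProj_mem_diagonal η, star_s_mul_rangeProj_mul_s_mem e η⟩)
    hx).2

/-- Compare (μ, μ) matrix coefficients in the boundary representation, where s_e takes δ_μ to
δ_{eμ}. -/
theorem diagonalHom_star_s_mul_mul_s (a : E.diagonal) (e : Edge) (μ : E.Boundary)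
    (h : E.s e = μ.range) :
    E.diagonalHom ⟨_, star_s_mul_mul_s_mem a.2 e⟩ μ = E.diagonalHom a (μ.cons e h) := by
  classical
  have h1 := mulOp_diagonalHom (⟨_, star_s_mul_mul_s_mem a.2 e⟩ : E.diagonal)
  rw [map_mul, map_mul, map_star, ← mulOp_diagonalHom, boundaryRep_s, star_pequivOp] at h1
  have h2 := congrArg
    (fun T : EllTwo E.Boundary →L[ℂ] EllTwo E.Boundary => T (lp.single 2 μ (1 : ℂ)) μ) h1
  change E.diagonalHom ⟨_, star_s_mul_mul_s_mem a.2 e⟩ μ * _ = ((E.edgePEquiv e).symm μ).elim 0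
    (fun ν => E.diagonalHom a ν * (E.edgePEquiv e ν).elim 0 (lp.single 2 μ (1 : ℂ))) at h2
  rw [edgePEquiv_symm_apply e μ h, Option.elim_some, edgePEquiv_cons, Option.elim_some] at h2
  simpa using h2

theorem diagonalHom_star_s_mul_mul_s_of_ne (a : E.diagonal) (e : Edge) (μ : E.Boundary)
    (h : E.s e ≠ μ.range) :
    E.diagonalHom ⟨_, star_s_mul_mul_s_mem a.2 e⟩ μ = 0 := by
  classical
  have h1 := mulOp_diagonalHom (⟨_, star_s_mul_mul_s_mem a.2 e⟩ : E.diagonal)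
  rw [map_mul, map_mul, map_star, ← mulOp_diagonalHom, boundaryRep_s, star_pequivOp] at h1
  have h2 := congrArg
    (fun T : EllTwo E.Boundary →L[ℂ] EllTwo E.Boundary => T (lp.single 2 μ (1 : ℂ)) μ) h1
  change E.diagonalHom ⟨_, star_s_mul_mul_s_mem a.2 e⟩ μ * _ = ((E.edgePEquiv e).symm μ).elim 0
    (fun ν => E.diagonalHom a ν * (E.edgePEquiv e ν).elim 0 (lp.single 2 μ (1 : ℂ))) at h2
  rw [edgePEquiv_symm_apply_of_ne e μ h, Option.elim_none] at h2
  simpa using h2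

variable {lam : Edge → ℝ} {Φ : E.GraphCStar →CP E.GraphCStar}

/-- On D_E the terms with e ≠ f vanish and the double sum collapses to a single one. -/
theorem IsPerronFrobenius.tendsto_diagonal (hlam : ∀ e, 0 < lam e) (hΦ : E.IsPerronFrobenius lam Φ)
    {a : E.GraphCStar} (ha : a ∈ E.diagonal) :
    Tendsto (fun F : Finset Edge =>
      ∑ e ∈ F, (lam e : ℂ) • (star (E.univ.s e) * a * E.univ.s e)) atTop (𝓝 (Φ a)) := by
  refine (hΦ a).congr fun F => Finset.sum_congr rfl fun e he => ?_
  rw [Finset.sum_eq_single e, Real.sqrt_mul_self (hlam e).le]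
  · intro f _ hf
    rw [star_s_mul_mul_s_of_ne ha hf.symm, smul_zero]
  · exact fun h => absurd he h

theorem IsPerronFrobenius.apply_mem_diagonal (hlam : ∀ e, 0 < lam e)
    (hΦ : E.IsPerronFrobenius lam Φ) {a : E.GraphCStar} (ha : a ∈ E.diagonal) :
    Φ a ∈ E.diagonal :=
  E.isClosed_diagonal.mem_of_tendsto (hΦ.tendsto_diagonal hlam ha) <| .of_forall fun _ =>
    sum_mem fun e _ => SMulMemClass.smul_mem _ (star_s_mul_mul_s_mem ha e)

theorem IsPerronFrobenius.hasSum_diagonalHom (hlam : ∀ e, 0 < lam e)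
    (hΦ : E.IsPerronFrobenius lam Φ) (a : E.diagonal) (μ : E.Boundary) :
    HasSum (fun e : {e : Edge // E.s e = μ.range} =>
      (lam e : ℂ) * E.diagonalHom a (μ.cons e.1 e.2))
      (E.diagonalHom ⟨Φ a, hΦ.apply_mem_diagonal hlam a.2⟩ μ) := by
  have h1 : HasSum (fun e => (lam e : ℂ) • (⟨_, star_s_mul_mul_s_mem a.2 e⟩ : E.diagonal))
      ⟨Φ a, hΦ.apply_mem_diagonal hlam a.2⟩ := by
    refine tendsto_subtype_rng.2 ((hΦ.tendsto_diagonal hlam a.2).congr fun F => ?_)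
    rw [AddSubmonoidClass.coe_finsetSum]
    rfl
  have h2 := h1.map (diagonalEval μ) (map_continuous _)
  have hsupp : Function.support (diagonalEval μ ∘ fun e => (lam e : ℂ) •
      (⟨_, star_s_mul_mul_s_mem a.2 e⟩ : E.diagonal)) ⊆ {e | E.s e = μ.range} := by
    intro e he
    by_contra h
    refine he ?_
    rw [Function.comp_apply, map_smul]
    change _ • E.diagonalHom _ μ = 0
    rw [diagonalHom_star_s_mul_mul_s_of_ne a e μ h, smul_zero]
  refine (congrArg (HasSum · _) (funext fun e => ?_)).mpr
    ((hasSum_subtype_iff_of_support_subset hsupp).2 h2)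
  rw [Function.comp_apply, Function.comp_apply, map_smul, ← diagonalHom_star_s_mul_mul_s]
  rfl

theorem IsPerronFrobenius.exists_isTransferOperator (hlam : ∀ e, 0 < lam e)
    (hΦ : E.IsPerronFrobenius lam Φ) :
    ∃ L : C₀(E.Boundary, ℂ) →L[ℂ] C₀(E.Boundary, ℂ), E.IsTransferOperator lam L := by
  -- Positive maps between C⋆-algebras are automatically bounded, and ψ is isometric, so C also
  -- bounds L.
  obtain ⟨C, hC⟩ := PositiveLinearMap.exists_norm_apply_le (PositiveLinearMap.ofClass Φ)
  have hiso := NonUnitalStarAlgHom.isometry E.diagonalHom E.diagonalHom_injective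
  refine ⟨LinearMap.mkContinuous
    { toFun := fun f => E.diagonalHom ⟨Φ (E.diagonalEquiv.symm f),
        hΦ.apply_mem_diagonal hlam (E.diagonalEquiv.symm f).2⟩
      map_add' := fun f g => ?_
      map_smul' := fun c f => ?_ } C fun f => ?_, fun f μ => ?_⟩
  · rw [← map_add]
    congr 1
    apply Subtype.ext
    simp
  · rw [RingHom.id_apply, ← map_smul]
    congr 1
    apply Subtype.ext
    simp
  · change ‖E.diagonalHom _‖ ≤ _
    rw [(AddMonoidHomClass.isometry_iff_norm _).1 hiso]
    refine (hC _).trans_eq ?_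
    congr 1
    have := (AddMonoidHomClass.isometry_iff_norm _).1 hiso (E.diagonalEquiv.symm f)
    rw [← diagonalEquiv_apply, StarAlgEquiv.apply_symm_apply] at this
    exact this.symm
  · have := hΦ.hasSum_diagonalHom hlam (E.diagonalEquiv.symm f) μ
    rw [← diagonalEquiv_apply (E.diagonalEquiv.symm f), StarAlgEquiv.apply_symm_apply] at this
    exact this

theorem IsPerronFrobenius.diagonalEquiv_apply_eq (hlam : ∀ e, 0 < lam e)
    (hΦ : E.IsPerronFrobenius lam Φ) {L : C₀(E.Boundary, ℂ) →L[ℂ] C₀(E.Boundary, ℂ)}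
    (hL : E.IsTransferOperator lam L) (a : E.diagonal) :
    E.diagonalEquiv ⟨Φ a, hΦ.apply_mem_diagonal hlam a.2⟩ = L (E.diagonalEquiv a) := by
  ext μ
  exact (hΦ.hasSum_diagonalHom hlam a μ).unique (hL _ μ)

end DirGraph

/-! ### Multipliers and strict sums -/

section Multipliers

variable {A : Type w} [NonUnitalCStarAlgebra A] {ι : Type v}

namespace DoubleCentralizer

/-- Here `m.fst a` is the product ma and `m.snd a` is am. Centrality shows that the difference of
the two sides annihilates every z, in particular its own adjoint, so it is zero. -/
theorem snd_mul_right (m : 𝓜(ℂ, A)) (x y : A) : m.snd (x * y) = x * m.snd y := by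
  have h : ∀ z, (m.snd (x * y) - x * m.snd y) * z = 0 := fun z => by
    rw [sub_mul, m.central, mul_assoc, mul_assoc, m.central, sub_self]
  exact sub_eq_zero.1 ((CStarRing.mul_star_self_eq_zero_iff _).1 (h _))

theorem fst_mul_left (m : 𝓜(ℂ, A)) (x y : A) : m.fst (x * y) = m.fst x * y := by
  have h : ∀ z, z * (m.fst (x * y) - m.fst x * y) = 0 := fun z => by
    rw [mul_sub, ← m.central, ← mul_assoc, ← mul_assoc, ← m.central, sub_self]
  exact sub_eq_zero.1 ((CStarRing.star_mul_self_eq_zero_iff _).1 (h _))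

/-- The map `a ↦ m⋆ a m`, for a multiplier `m`. -/
noncomputable def conj (m : 𝓜(ℂ, A)) : A →ₗ[ℂ] A := ((star m).fst ∘L m.snd : A →L[ℂ] A)

theorem conj_apply (m : 𝓜(ℂ, A)) (a : A) : m.conj a = star (m.snd (star (m.snd a))) := rfl

theorem coe_conj (m : 𝓜(ℂ, A)) (a : A) :
    (m.conj a : 𝓜(ℂ, A)) = star m * (a : 𝓜(ℂ, A)) * m := by
  refine DoubleCentralizer.ext ℂ A _ _ (Prod.ext ?_ ?_)
  · ext b
    change (star m).fst (m.snd a) * b = (star m).fst (a * m.fst b)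
    rw [← fst_mul_left, m.central]
  · ext b
    change b * (star m).fst (m.snd a) = m.snd ((star m).snd b * a)
    rw [snd_mul_right, (star m).central]

/-- The source of complete positivity: entrywise, N⋆N is sent to (Nm)⋆(Nm). -/
theorem conj_star_mul (m : 𝓜(ℂ, A)) (a b : A) :
    m.conj (star a * b) = star (m.snd a) * m.snd b := by
  rw [conj_apply, snd_mul_right, star_mul, star_star, snd_mul_right, star_mul, star_star]

/-- The completely positive map `a ↦ m⋆ a m`, for a multiplier `m`. -/
noncomputable def conjCP [PartialOrder A] [StarOrderedRing A] (m : 𝓜(ℂ, A)) : A →CP A where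
  toLinearMap := m.conj
  map_cstarMatrix_nonneg' k M hM := by
    rw [StarOrderedRing.nonneg_iff] at hM
    induction hM using AddSubmonoid.closure_induction with
    | mem M hM =>
      obtain ⟨N, rfl⟩ := hM
      have h : (star N * N).map m.conj = star (N.map m.snd) * N.map m.snd := by
        ext i j
        change m.conj (∑ l, star (N l i) * N l j) = ∑ l, star (m.snd (N l i)) * m.snd (N l j)
        rw [map_sum]
        exact Finset.sum_congr rfl fun l _ => m.conj_star_mul _ _
      exact h ▸ star_mul_self_nonneg _
    | zero =>
      have h : (0 : CStarMatrix (Fin k) (Fin k) A).map m.conj = 0 := by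
        ext i j
        exact map_zero m.conj
      exact h.ge
    | add M N _ _ hM hN =>
      have h : (M + N).map m.conj = M.map m.conj + N.map m.conj := by
        ext i j
        exact map_add m.conj _ _
      exact h ▸ add_nonneg hM hN

end DoubleCentralizer

theorem hasStrictSum_iff {f : ι → 𝓜(ℂ, A)} {m : 𝓜(ℂ, A)} :
    HasStrictSum f m ↔ ∀ a, HasSum (fun i => (f i).fst a) (m.fst a) ∧
      HasSum (fun i => (f i).snd a) (m.snd a) := by
  have hfst : ∀ (F : Finset ι) a, (∑ i ∈ F, f i).fst a = ∑ i ∈ F, (f i).fst a := fun F a =>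
    map_sum (⟨⟨fun m : 𝓜(ℂ, A) => m.fst a, rfl⟩, fun _ _ => rfl⟩ : 𝓜(ℂ, A) →+ A) _ _
  have hsnd : ∀ (F : Finset ι) a, (∑ i ∈ F, f i).snd a = ∑ i ∈ F, (f i).snd a := fun F a =>
    map_sum (⟨⟨fun m : 𝓜(ℂ, A) => m.snd a, rfl⟩, fun _ _ => rfl⟩ : 𝓜(ℂ, A) →+ A) _ _
  rw [HasStrictSum, strictTopology, nhds_iInf, tendsto_iInf]
  refine forall_congr' fun a => ?_
  have h : @nhds _ (TopologicalSpace.induced (fun m : 𝓜(ℂ, A) => m.fst a) inferInstance ⊓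
      TopologicalSpace.induced (fun m : 𝓜(ℂ, A) => m.snd a) inferInstance) m =
      comap (fun m : 𝓜(ℂ, A) => m.fst a) (𝓝 (m.fst a)) ⊓
        comap (fun m : 𝓜(ℂ, A) => m.snd a) (𝓝 (m.snd a)) := by
    rw [← nhds_induced, ← nhds_induced]
    exact @nhds_inf 𝓜(ℂ, A) (.induced (fun m => m.fst a) inferInstance)
      (.induced (fun m => m.snd a) inferInstance) m
  refine (congrArg (Tendsto _ _) h).to_iff.trans ?_
  rw [tendsto_inf, tendsto_comap_iff, tendsto_comap_iff]
  simp only [Function.comp_def, hfst, hsnd]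
  rfl

theorem isClosed_summable_mul {T : ι → A} {C : ℝ} (hT : ∀ F : Finset ι, ‖∑ i ∈ F, T i‖ ≤ C) :
    IsClosed {a | Summable fun i => T i * a} := by
  have hC : 0 ≤ C := (norm_nonneg _).trans (hT ∅)
  refine isClosed_of_closure_subset fun a ha => ?_
  rw [Set.mem_ofPred_eq, summable_iff_vanishing_norm]
  intro ε hε
  -- C + 1 instead of C, since C may be 0.
  obtain ⟨b, hb, hab⟩ := Metric.mem_closure_iff.1 ha (ε / 2 / (C + 1)) (by positivity)
  obtain ⟨s, hs⟩ := summable_iff_vanishing_norm.1 hb (ε / 2) (half_pos hε)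
  refine ⟨s, fun t ht => ?_⟩
  have h : ∑ i ∈ t, T i * a = ∑ i ∈ t, T i * b + (∑ i ∈ t, T i) * (a - b) := by
    rw [Finset.sum_mul, ← Finset.sum_add_distrib]
    exact Finset.sum_congr rfl fun i _ => by rw [mul_sub]; abel
  rw [h, ← add_halves ε]
  refine (norm_add_le _ _).trans_lt (add_lt_add_of_lt_of_le (hs t ht) ?_)
  rw [dist_eq_norm, lt_div_iff₀ (by positivity)] at hab
  calc ‖(∑ i ∈ t, T i) * (a - b)‖ ≤ C * ‖a - b‖ :=
        (norm_mul_le _ _).trans (mul_le_mul_of_nonneg_right (hT t) (norm_nonneg _))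
    _ ≤ ε / 2 := by nlinarith [norm_nonneg (a - b)]

/-- The elements `a` for which `∑ i, T i * a` and `∑ i, T i * star a` converge, for a series with
bounded partial sums. -/
def mulSummable (T : ι → A) : NonUnitalStarSubalgebra ℂ A where
  -- The first condition alone gives a right ideal; the second makes the set closed under the
  -- adjoint, so that it can be tested on the generators of a C⋆-algebra.
  carrier := {a | (Summable fun i => T i * a) ∧ Summable fun i => T i * star a}
  add_mem' {a b} ha hb := by
    constructor
    · simpa [mul_add] using ha.1.add hb.1
    · simpa [mul_add] using ha.2.add hb.2
  zero_mem' := by simp [summable_zero]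
  mul_mem' {a b} ha hb := by
    constructor
    · simpa [mul_assoc] using ha.1.mul_right b
    · simpa [mul_assoc] using hb.2.mul_right (star a)
  smul_mem' c a ha := by
    constructor
    · simpa [mul_smul_comm] using ha.1.const_smul c
    · simpa [mul_smul_comm] using ha.2.const_smul (star c)
  star_mem' {a} ha := ⟨ha.2, by simpa using ha.1⟩

theorem isClosed_mulSummable {T : ι → A} {C : ℝ} (hT : ∀ F : Finset ι, ‖∑ i ∈ F, T i‖ ≤ C) :
    IsClosed (mulSummable T : Set A) :=
  (isClosed_summable_mul hT).inter ((isClosed_summable_mul hT).preimage continuous_star)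

/-- A series with bounded partial sums that converges after multiplication by any element of the
algebra, on either side, converges to a multiplier. -/
theorem exists_multiplier_hasSum {T : ι → A} {C : ℝ} (hT : ∀ F : Finset ι, ‖∑ i ∈ F, T i‖ ≤ C)
    (hl : ∀ a, Summable fun i => T i * a) (hr : ∀ a, Summable fun i => a * T i) :
    ∃ m : 𝓜(ℂ, A), ∀ a, HasSum (fun i => T i * a) (m.fst a) ∧
      HasSum (fun i => a * T i) (m.snd a) := by
  let f : A →L[ℂ] A := LinearMap.mkContinuous
    { toFun := fun a => ∑' i, T i * a
      map_add' := fun a b => by simp only [mul_add]; exact (hl a).tsum_add (hl b)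
      map_smul' := fun c a => by
        simp only [mul_smul_comm]; exact (hl a).tsum_const_smul c } C fun a =>
    le_of_tendsto (hl a).hasSum.norm <| .of_forall fun F => by
      rw [← Finset.sum_mul]
      exact (norm_mul_le _ _).trans (mul_le_mul_of_nonneg_right (hT F) (norm_nonneg _))
  let g : A →L[ℂ] A := LinearMap.mkContinuous
    { toFun := fun a => ∑' i, a * T i
      map_add' := fun a b => by simp only [add_mul]; exact (hr a).tsum_add (hr b)
      map_smul' := fun c a => by
        simp only [smul_mul_assoc]; exact (hr a).tsum_const_smul c } C fun a =>
    le_of_tendsto (hr a).hasSum.norm <| .of_forall fun F => by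
      rw [← Finset.mul_sum, mul_comm C]
      exact (norm_mul_le _ _).trans (mul_le_mul_of_nonneg_left (hT F) (norm_nonneg _))
  refine ⟨⟨(f, g), fun x y => ?_⟩, fun a => ⟨(hl a).hasSum, (hr a).hasSum⟩⟩
  have h1 := (hr x).hasSum.mul_right y
  have h2 := (hl y).hasSum.mul_left x
  simp only [← mul_assoc] at h2
  exact h1.unique h2

theorem tendsto_star_mul_mul {T : ι → A} {C : ℝ} (hT : ∀ F : Finset ι, ‖∑ i ∈ F, T i‖ ≤ C)
    {m : 𝓜(ℂ, A)} (hm : ∀ a, HasSum (fun i => a * T i) (m.snd a)) (a : A) :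
    Tendsto (fun F : Finset ι => star (∑ i ∈ F, T i) * a * ∑ i ∈ F, T i) atTop
      (𝓝 (m.conj a)) := by
  have hm' : ∀ a, Tendsto (fun F : Finset ι => a * ∑ i ∈ F, T i) atTop (𝓝 (m.snd a)) := fun a =>
    Tendsto.congr (fun F => (Finset.mul_sum _ _ _).symm) (hm a)
  have h1 := (hm' a).star
  -- With u_F the partial sums, (a u_F)⋆ u_F is split as ((a u_F)⋆ - (am)⋆) u_F + (am)⋆ u_F. The
  -- first term tends to 0 since u_F is bounded, the second to (am)⋆ m; then take adjoints.
  have h2 : Tendsto (fun F : Finset ι =>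
      (star (a * ∑ i ∈ F, T i) - star (m.snd a)) * ∑ i ∈ F, T i) atTop (𝓝 0) := by
    refine squeeze_zero_norm (fun F => (norm_mul_le _ _).trans
      (mul_le_mul_of_nonneg_left (hT F) (norm_nonneg _))) ?_
    have := ((tendsto_sub_nhds_zero_iff.2 h1).norm).mul_const C
    simpa using this
  have h3 := (h2.add (hm' (star (m.snd a)))).star
  rw [zero_add, ← DoubleCentralizer.conj_apply] at h3
  refine h3.congr fun F => ?_
  rw [sub_mul, sub_add_cancel, star_mul, star_star, mul_assoc]

end Multipliers

namespace DirGraph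

variable {V : Type u} {Edge : Type v} {E : DirGraph V Edge}

/-! ### Partial sums of `u_λ` -/

/-- The induction principle for C⋆(E), used to spread convergence of the series from p_v and s_e to
every element. -/
theorem eq_top_of_generators_mem {K : NonUnitalStarSubalgebra ℂ E.GraphCStar}
    (hK : IsClosed (K : Set E.GraphCStar)) (hp : ∀ v, E.univ.p v ∈ K) (hs : ∀ e, E.univ.s e ∈ K)
    (a : E.GraphCStar) : a ∈ K := by
  let K' : NonUnitalStarSubalgebra ℂ E.universalSubalgebra := K
  have hle : E.universalSubalgebra ≤
      K'.map (NonUnitalStarSubalgebraClass.subtype E.universalSubalgebra) := by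
    refine NonUnitalStarSubalgebra.topologicalClosure_minimal _
      (NonUnitalStarAlgebra.adjoin_le ?_) ?_
    · rintro _ (⟨v, rfl⟩ | ⟨e, rfl⟩)
      · exact ⟨E.univ.p v, hp v, rfl⟩
      · exact ⟨E.univ.s e, hs e, rfl⟩
    · rw [NonUnitalStarSubalgebra.coe_map]
      exact (NonUnitalStarSubalgebra.isClosed_topologicalClosure
        _).isClosedEmbedding_subtypeVal.isClosedMap _ hK
  obtain ⟨y, hy, hya⟩ := hle (show E.universalSubalgebra from a).2
  obtain rfl : y = a := Subtype.ext hya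
  exact hy

variable {lam : Edge → ℝ}

/-- The term `√λ_e s_e` of the series `u_λ`. -/
noncomputable def uTerm (E : DirGraph V Edge) (lam : Edge → ℝ) (e : Edge) : E.GraphCStar :=
  ((√(lam e) : ℝ) : ℂ) • E.univ.s e

theorem star_sum_uTerm_mul_sum_uTerm (hlam : ∀ e, 0 < lam e) (F : Finset Edge) :
    star (∑ e ∈ F, E.uTerm lam e) * ∑ e ∈ F, E.uTerm lam e =
      ∑ e ∈ F, (lam e : ℂ) • E.univ.p (E.s e) := by
  rw [star_sum, Finset.sum_mul]
  refine Finset.sum_congr rfl fun e he => ?_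
  rw [Finset.mul_sum, Finset.sum_eq_single e]
  · rw [uTerm, star_smul, smul_mul_smul_comm, E.univ.star_s_mul_s]
    congr 1
    rw [RCLike.star_def, Complex.conj_ofReal, ← Complex.ofReal_mul,
      Real.mul_self_sqrt (hlam e).le]
  · intro f _ hf
    rw [uTerm, uTerm, star_smul, smul_mul_smul_comm, E.univ.star_s_mul_s_of_ne hf.symm, smul_zero]
  · exact fun h => absurd he h

open scoped Classical in
-- Grouping the edges by source leaves a combination of mutually orthogonal projections of norm 1,
-- whose norm is its largest coefficient.
theorem norm_sum_smul_p (F : Finset Edge) (hlam : ∀ e, 0 < lam e) {M : ℝ} (hM : 0 ≤ M) :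
    ‖∑ e ∈ F, (lam e : ℂ) • E.univ.p (E.s e)‖ ≤ M ↔
      ∀ v, ∑ e ∈ F with E.s e = v, lam e ≤ M := by
  lift M to NNReal using hM
  let c : V → ℝ := fun v => ∑ e ∈ F with E.s e = v, lam e
  have hc : ∀ v, 0 ≤ c v := fun v => Finset.sum_nonneg fun e _ => (hlam e).le
  have h1 : ∑ e ∈ F, (lam e : ℂ) • E.univ.p (E.s e) =
      ∑ v ∈ F.image E.s, (c v : ℂ) • E.univ.p v := by
    rw [← Finset.sum_fiberwise_of_maps_to (fun e he => Finset.mem_image_of_mem E.s he)]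
    refine Finset.sum_congr rfl fun v _ => ?_
    rw [Complex.ofReal_sum, Finset.sum_smul]
    refine Finset.sum_congr rfl fun e he => ?_
    rw [(Finset.mem_filter.1 he).2]
  have h2 := IsSelfAdjoint.nnnorm_sum_eq_sup (f := fun v => (c v : ℂ) • E.univ.p v)
    (F.image E.s) (fun v _ => IsSelfAdjoint.smul (by simp [IsSelfAdjoint])
      (E.univ.isStarProjection_p v).isSelfAdjoint) fun v v' hv => by
      change (c v : ℂ) • E.univ.p v * (c v' : ℂ) • E.univ.p v' = 0
      rw [smul_mul_smul_comm, E.univ.p_mul_p v v' hv, smul_zero]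
  have h3 : ∀ v, ‖(c v : ℂ) • E.univ.p v‖ = c v := fun v => by
    rw [norm_smul, norm_univ_p, mul_one, Complex.norm_real, Real.norm_of_nonneg (hc v)]
  rw [h1, ← coe_nnnorm, h2, NNReal.coe_le_coe, Finset.sup_le_iff]
  constructor
  · intro h v
    by_cases hv : v ∈ F.image E.s
    · have := h v hv
      rw [← NNReal.coe_le_coe, coe_nnnorm, h3] at this
      exact this
    · rw [Finset.filter_eq_empty_iff.2 fun e he hev => hv (Finset.mem_image.2 ⟨e, he, hev⟩)]
      simp
  · intro h v _
    rw [← NNReal.coe_le_coe, coe_nnnorm, h3]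
    exact h v

open scoped Classical in
-- The C⋆-identity turns the norm of a partial sum into sums of λ over edges with a common source.
-- All estimates on u_λ come from this.
theorem norm_sum_uTerm_sq_le_iff (F : Finset Edge) (hlam : ∀ e, 0 < lam e) {M : ℝ} (hM : 0 ≤ M) :
    ‖∑ e ∈ F, E.uTerm lam e‖ ^ 2 ≤ M ↔ ∀ v, ∑ e ∈ F with E.s e = v, lam e ≤ M := by
  rw [sq, ← CStarRing.norm_star_mul_self, star_sum_uTerm_mul_sum_uTerm hlam,
    norm_sum_smul_p F hlam hM]

theorem p_mul_uTerm (v : V) (e : Edge) [Decidable (E.r e = v)] :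
    E.univ.p v * E.uTerm lam e = if E.r e = v then E.uTerm lam e else 0 := by
  split_ifs with h
  · rw [uTerm, mul_smul_comm, ← h, E.univ.p_mul_s]
  · rw [uTerm, mul_smul_comm, E.univ.p_mul_s_of_ne h, smul_zero]

theorem uTerm_mul_p (v : V) (e : Edge) [Decidable (E.s e = v)] :
    E.uTerm lam e * E.univ.p v = if E.s e = v then E.uTerm lam e else 0 := by
  split_ifs with h
  · rw [uTerm, smul_mul_assoc, ← h, E.univ.s_mul_p]
  · rw [uTerm, smul_mul_assoc, E.univ.s_mul_p_of_ne h, smul_zero]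

theorem isULambda_iff {m : 𝓜(ℂ, E.GraphCStar)} :
    E.IsULambda lam m ↔ ∀ a, HasSum (fun e => E.uTerm lam e * a) (m.fst a) ∧
      HasSum (fun e => a * E.uTerm lam e) (m.snd a) := by
  rw [IsULambda, hasStrictSum_iff]
  refine forall_congr' fun a => ?_
  have h1 : ∀ e, ((((√(lam e) : ℝ) : ℂ) • E.univ.s e : 𝓜(ℂ, E.GraphCStar))).fst a =
      E.uTerm lam e * a := fun e =>
    (smul_mul_assoc ((√(lam e) : ℝ) : ℂ) (E.univ.s e) a).symm
  have h2 : ∀ e, ((((√(lam e) : ℝ) : ℂ) • E.univ.s e : 𝓜(ℂ, E.GraphCStar))).snd a =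
      a * E.uTerm lam e := fun e =>
    (mul_smul_comm ((√(lam e) : ℝ) : ℂ) a (E.univ.s e)).symm
  simp only [h1, h2]

/-- Strict convergence of `u_λ` bounds the sums of `λ` over edges with a given source. -/
theorem IsULambda.norm_sum_uTerm_le (hlam : ∀ e, 0 < lam e) {m : 𝓜(ℂ, E.GraphCStar)}
    (hm : E.IsULambda lam m) (F : Finset Edge) : ‖∑ e ∈ F, E.uTerm lam e‖ ≤ ‖m‖ := by
  classical
  refine le_of_sq_le_sq ?_ (norm_nonneg _)
  rw [norm_sum_uTerm_sq_le_iff F hlam (sq_nonneg _)]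
  intro v
  have h1 := ((isULambda_iff.1 hm (E.univ.p v)).1.norm).pow 2
  have h2 : ∑ e ∈ F with E.s e = v, lam e ≤ ‖m.fst (E.univ.p v)‖ ^ 2 := by
    -- For G ⊇ F, u_G p_v is the partial sum over the edges of G with source v, and its squared norm
    -- dominates the sum of λ over the edges of F with source v.
    refine ge_of_tendsto h1 ((eventually_ge_atTop F).mono fun G hG => ?_)
    simp only [uTerm_mul_p]
    rw [← Finset.sum_filter]
    have h3 := (norm_sum_uTerm_sq_le_iff (E := E) (G.filter fun e => E.s e = v) hlam
      (sq_nonneg _)).1 le_rfl v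
    rw [Finset.filter_filter] at h3
    simp only [and_self] at h3
    exact (Finset.sum_le_sum_of_subset_of_nonneg (Finset.filter_subset_filter _ hG)
      fun e _ _ => (hlam e).le).trans h3
  refine h2.trans (pow_le_pow_left₀ (norm_nonneg _) ?_ 2)
  have := m.fst.le_opNorm (E.univ.p v)
  rwa [norm_univ_p, mul_one, DoubleCentralizer.norm_fst] at this

theorem sum_sum_smul_eq (hlam : ∀ e, 0 < lam e) (F : Finset Edge) (a : E.GraphCStar) :
    ∑ e ∈ F, ∑ f ∈ F, ((√(lam e * lam f) : ℝ) : ℂ) • (star (E.univ.s e) * a * E.univ.s f) =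
      star (∑ e ∈ F, E.uTerm lam e) * a * ∑ e ∈ F, E.uTerm lam e := by
  rw [star_sum, Finset.sum_mul, Finset.sum_mul]
  refine Finset.sum_congr rfl fun e _ => ?_
  rw [Finset.mul_sum]
  refine Finset.sum_congr rfl fun f _ => ?_
  rw [uTerm, uTerm, star_smul, smul_mul_assoc, smul_mul_smul_comm, RCLike.star_def,
    Complex.conj_ofReal, ← Complex.ofReal_mul, Real.sqrt_mul (hlam e).le]

theorem IsULambda.tendsto_conj (hlam : ∀ e, 0 < lam e) {m : 𝓜(ℂ, E.GraphCStar)}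
    (hm : E.IsULambda lam m) (a : E.GraphCStar) :
    Tendsto (fun F : Finset Edge => ∑ e ∈ F, ∑ f ∈ F,
        ((√(lam e * lam f) : ℝ) : ℂ) • (star (E.univ.s e) * a * E.univ.s f))
      atTop (𝓝 (m.conj a)) :=
  (tendsto_star_mul_mul (hm.norm_sum_uTerm_le hlam) (fun a => (isULambda_iff.1 hm a).2) a).congr
    fun F => (sum_sum_smul_eq hlam F a).symm

theorem IsULambda.isPerronFrobenius (hlam : ∀ e, 0 < lam e) {m : 𝓜(ℂ, E.GraphCStar)}
    (hm : E.IsULambda lam m) : E.IsPerronFrobenius lam m.conjCP := hm.tendsto_conj hlam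

/-! ### Convergence of `u_λ` -/

open scoped Classical in
theorem SourceSumsBounded.exists_bound (hlam : ∀ e, 0 < lam e) (h : E.SourceSumsBounded lam) :
    ∃ M, 0 ≤ M ∧ ∀ (F : Finset Edge) v, ∑ e ∈ F with E.s e = v, lam e ≤ M := by
  obtain ⟨C, hC⟩ := h.2.bddAbove
  -- With no edges C bounds an empty family and may be negative.
  refine ⟨max C 0, le_max_right _ _, fun F v => ?_⟩
  by_cases hv : v ∈ Set.range E.s
  · refine le_trans ?_ (((Real.le_norm_self _).trans (hC ⟨⟨v, hv⟩, rfl⟩)).trans (le_max_left _ _))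
    rw [← Finset.sum_subtype_eq_sum_filter]
    exact (h.1 v hv).sum_le_tsum _ fun e _ => (hlam e).le
  · rw [Finset.filter_eq_empty_iff.2 fun e _ hev => hv ⟨e, hev⟩]
    exact le_max_right _ _

theorem summable_of_vanishing_sq {ι : Type v} {A : Type w} [NormedAddCommGroup A] [CompleteSpace A]
    {f : ι → A} (h : ∀ ε > 0, ∃ s : Finset ι, ∀ t, Disjoint t s → ‖∑ i ∈ t, f i‖ ^ 2 ≤ ε) :
    Summable f := by
  rw [summable_iff_vanishing_norm]
  intro ε hε
  obtain ⟨s, hs⟩ := h ((ε / 2) ^ 2) (by positivity)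
  exact ⟨s, fun t ht => (le_of_sq_le_sq (hs t ht) (by positivity)).trans_lt (half_lt_self hε)⟩

/-- Multiplying by p_v keeps only the edges with source v, so the squared norm of a finite block is
at most a block of the convergent sum of λ over s⁻¹(v). -/
theorem SourceSumsBounded.summable_uTerm_mul_p (hlam : ∀ e, 0 < lam e)
    (h : E.SourceSumsBounded lam) (v : V) : Summable fun e => E.uTerm lam e * E.univ.p v := by
  classical
  by_cases hv : v ∈ Set.range E.s
  · have h1 := h.1 v hv
    have h2 : Summable ({e | E.s e = v}.indicator lam) := (summable_subtype_iff_indicator).1 h1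
    refine summable_of_vanishing_sq fun ε hε => ?_
    obtain ⟨s, hs⟩ := summable_iff_vanishing_norm.1 h2 ε hε
    refine ⟨s, fun t ht => ?_⟩
    simp only [uTerm_mul_p]
    rw [← Finset.sum_filter, norm_sum_uTerm_sq_le_iff _ hlam hε.le]
    intro w
    refine le_trans (Finset.sum_le_sum_of_subset_of_nonneg (Finset.filter_subset _ _)
      fun e _ _ => (hlam e).le) ?_
    rw [Finset.sum_filter]
    exact (Real.le_norm_self _).trans (hs t ht).le
  · refine summable_zero.congr fun e => ?_
    rw [uTerm_mul_p, if_neg fun he => hv ⟨e, he⟩]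

/-- The squared norm of a block of p_v u_λ is the largest, over w, of its sums of λ over edges from
w to v. The c₀ condition makes these at most ε for all but finitely many w; for the remaining w,
convergence of each sum makes the tails small. -/
theorem RangeSumsVanish.summable_p_mul_uTerm (hlam : ∀ e, 0 < lam e)
    (h : E.RangeSumsVanish lam) (v : V) : Summable fun e => E.univ.p v * E.uTerm lam e := by
  classical
  by_cases hv : v ∈ Set.range E.r
  · obtain ⟨h1, h2⟩ := h v hv
    refine summable_of_vanishing_sq fun ε hε => ?_
    let W : Set (E.s '' {e | E.r e = v}) :=
      {w | ¬ dist (∑' e : {e : Edge // E.r e = v ∧ E.s e = w}, lam e) 0 < ε}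
    have hW : W.Finite := (Metric.tendsto_nhds.1 h2 ε hε :)
    -- Adding up the finitely many exceptional families gives one finite set s that serves all of
    -- them.
    have h3 : Summable fun e => ∑ w ∈ hW.toFinset,
        {e | E.r e = v ∧ E.s e = w}.indicator lam e :=
      summable_sum fun w _ => summable_subtype_iff_indicator.1 (h1 w.1 w.2)
    obtain ⟨s, hs⟩ := summable_iff_vanishing_norm.1 h3 ε hε
    refine ⟨s, fun t ht => ?_⟩
    simp only [p_mul_uTerm]
    rw [← Finset.sum_filter, norm_sum_uTerm_sq_le_iff _ hlam hε.le]
    intro w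
    rw [Finset.filter_filter]
    by_cases hw : w ∈ E.s '' {e | E.r e = v}
    · by_cases hwW : (⟨w, hw⟩ : E.s '' {e | E.r e = v}) ∈ W
      · refine le_trans ?_ ((Real.le_norm_self _).trans (hs t ht).le)
        rw [Finset.sum_filter]
        refine Finset.sum_le_sum fun e _ => ?_
        refine le_trans (le_of_eq ?_) (Finset.single_le_sum (s := hW.toFinset) (a := ⟨w, hw⟩)
          (f := fun w : E.s '' {e | E.r e = v} => {e | E.r e = v ∧ E.s e = w}.indicator lam e)
          (fun w _ => Set.indicator_nonneg (fun e _ => (hlam e).le) e)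
          (hW.mem_toFinset.2 hwW))
        by_cases he : E.r e = v ∧ E.s e = w
        · rw [if_pos he, Set.indicator_of_mem (show e ∈ {e | E.r e = v ∧ E.s e = w} from he)]
        · rw [if_neg he, Set.indicator_of_notMem (show e ∉ {e | E.r e = v ∧ E.s e = w} from he)]
      · have h4 : dist (∑' e : {e : Edge // E.r e = v ∧ E.s e = w}, lam e) 0 < ε :=
          not_not.1 hwW
        rw [dist_zero_right] at h4
        refine le_trans ?_ ((Real.le_norm_self _).trans h4.le)
        rw [← Finset.sum_subtype_eq_sum_filter]
        exact (h1 w hw).sum_le_tsum _ fun e _ => (hlam e).le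
    · refine (Finset.sum_eq_zero fun e he => ?_).trans_le hε.le
      obtain ⟨he1, he2⟩ := (Finset.mem_filter.1 he).2
      exact absurd ⟨e, he1, he2⟩ hw
  · refine summable_zero.congr fun e => ?_
    rw [p_mul_uTerm, if_neg fun he => hv ⟨e, he⟩]

theorem exists_isULambda (hlam : ∀ e, 0 < lam e) (hs : E.SourceSumsBounded lam)
    (hr : E.RangeSumsVanish lam) : ∃ m : 𝓜(ℂ, E.GraphCStar), E.IsULambda lam m := by
  classical
  obtain ⟨M, hM0, hM⟩ := hs.exists_bound hlam
  have hT : ∀ F : Finset Edge, ‖∑ e ∈ F, E.uTerm lam e‖ ≤ √M := fun F =>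
    Real.le_sqrt_of_sq_le ((norm_sum_uTerm_sq_le_iff F hlam hM0).2 (hM F))
  have hT' : ∀ F : Finset Edge, ‖∑ e ∈ F, star (E.uTerm lam e)‖ ≤ √M := fun F => by
    rw [← star_sum, norm_star]; exact hT F
  have hp := hs.summable_uTerm_mul_p hlam
  have hp' : ∀ v, Summable fun e => star (E.uTerm lam e) * E.univ.p v := fun v => by
    simpa [E.univ.star_p] using (hr.summable_p_mul_uTerm hlam v).star
  have hl : ∀ a, Summable fun e => E.uTerm lam e * a := fun a =>
    (eq_top_of_generators_mem (K := mulSummable (E.uTerm lam)) (isClosed_mulSummable hT)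
      (fun v => ⟨hp v, by rw [E.univ.star_p]; exact hp v⟩)
      -- Convergence at s_f and s_f⋆ follows from that at projections, as s_f = p_{r(f)} s_f and
      -- s_f⋆ = p_{s(f)} s_f⋆.
      (fun f => ⟨by simpa [mul_assoc, E.univ.p_mul_s] using (hp (E.r f)).mul_right (E.univ.s f), by
        have h1 : E.univ.p (E.s f) * star (E.univ.s f) = star (E.univ.s f) := by
          simpa [E.univ.star_p] using congrArg star (E.univ.s_mul_p f)
        simpa [mul_assoc, h1] using (hp (E.s f)).mul_right (star (E.univ.s f))⟩) a).1
  have hr' : ∀ a, Summable fun e => star (E.uTerm lam e) * a := fun a =>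
    (eq_top_of_generators_mem (K := mulSummable fun e => star (E.uTerm lam e))
      (isClosed_mulSummable hT')
      (fun v => ⟨hp' v, by rw [E.univ.star_p]; exact hp' v⟩)
      (fun f => ⟨by simpa [mul_assoc, E.univ.p_mul_s] using (hp' (E.r f)).mul_right (E.univ.s f), by
        have h1 : E.univ.p (E.s f) * star (E.univ.s f) = star (E.univ.s f) := by
          simpa [E.univ.star_p] using congrArg star (E.univ.s_mul_p f)
        simpa [mul_assoc, h1] using (hp' (E.s f)).mul_right (star (E.univ.s f))⟩) a).1
  obtain ⟨m, hm⟩ := exists_multiplier_hasSum hT hl fun a => by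
    simpa using (hr' (star a)).star
  exact ⟨m, isULambda_iff.2 hm⟩

end DirGraph

namespace DirGraph

variable {V : Type u} {Edge : Type v} {E : DirGraph V Edge}

/-! ### Necessity of the summability conditions -/

variable {lam : Edge → ℝ} {L : C₀(E.Boundary, ℂ) →L[ℂ] C₀(E.Boundary, ℂ)}

theorem _root_.ZeroAtInftyContinuousMap.norm_le {X : Type*} [TopologicalSpace X] (f : C₀(X, ℂ)) {M : ℝ}
    (hM : 0 ≤ M) (h : ∀ x, ‖f x‖ ≤ M) : ‖f‖ ≤ M :=
  (BoundedContinuousFunction.norm_le (f := f.toBCF) hM).2 h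

open scoped Classical in
theorem cylFun_edge_apply_cons (e f : Edge) (μ : E.Boundary) (h : E.s f = μ.range) :
    cylFun (.edge E e) (μ.cons f h) = if f = e then 1 else 0 := by
  split_ifs with hfe
  · subst hfe
    exact cylFun_apply_of_mem (mem_cylinder_edge.2 ⟨μ, h, rfl⟩)
  · exact cylFun_apply_of_notMem (notMem_cylinder_edge hfe _ (mem_cylinder_edge.2 ⟨μ, h, rfl⟩))

theorem _root_.ZeroAtInftyContinuousMap.sum_apply {X ι : Type*} [TopologicalSpace X] (F : Finset ι)
    (f : ι → C₀(X, ℂ)) (x : X) : (∑ i ∈ F, f i) x = ∑ i ∈ F, f i x :=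
  map_sum (⟨⟨fun g : C₀(X, ℂ) => g x, rfl⟩, fun _ _ => rfl⟩ : C₀(X, ℂ) →+ ℂ) _ _

theorem norm_sum_cylFun_edge_le (F : Finset Edge) : ‖∑ e ∈ F, cylFun (.edge E e)‖ ≤ 1 := by
  classical
  refine ZeroAtInftyContinuousMap.norm_le _ zero_le_one fun μ => ?_
  rw [ZeroAtInftyContinuousMap.sum_apply]
  by_cases h : ∃ e ∈ F, μ ∈ E.cylinder (.edge E e)
  · obtain ⟨e, he, hμ⟩ := h
    rw [Finset.sum_eq_single e
      (fun f _ hf => cylFun_apply_of_notMem (notMem_cylinder_edge hf.symm μ hμ))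
      (fun h => absurd he h), cylFun_apply_of_mem hμ, norm_one]
  · push Not at h
    rw [Finset.sum_eq_zero fun e he => cylFun_apply_of_notMem (h e he), norm_zero]
    exact zero_le_one

/-- Apply L to the sum of χ_{D_e} over e ∈ F, which has norm at most 1, and evaluate at a boundary
path with range v. -/
theorem IsTransferOperator.sum_le (hlam : ∀ e, 0 < lam e) (hL : E.IsTransferOperator lam L)
    (v : V) (F : Finset {e : Edge // E.s e = v}) : ∑ e ∈ F, lam e ≤ ‖L‖ := by
  classical
  obtain ⟨μ, rfl⟩ := E.exists_boundary_range_eq v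
  let a : C₀(E.Boundary, ℂ) := ∑ e ∈ F.map (Function.Embedding.subtype _), cylFun (.edge E e)
  have ha : ∀ e : {e : Edge // E.s e = μ.range}, a (μ.cons e.1 e.2) = if e ∈ F then 1 else 0 := by
    intro e
    rw [ZeroAtInftyContinuousMap.sum_apply, Finset.sum_map]
    simp only [cylFun_edge_apply_cons, Function.Embedding.subtype_apply, Subtype.val_inj]
    rw [Finset.sum_ite_eq]
  have h1 : HasSum (fun e : {e : Edge // E.s e = μ.range} => (lam e : ℂ) * a (μ.cons e.1 e.2))
      (∑ e ∈ F, (lam e : ℂ) * a (μ.cons e.1 e.2)) :=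
    hasSum_sum_of_ne_finset_zero fun e he => by rw [ha, if_neg he, mul_zero]
  have h2 : L a μ = ((∑ e ∈ F, lam e : ℝ) : ℂ) := by
    rw [(hL a μ).unique h1, Complex.ofReal_sum]
    exact Finset.sum_congr rfl fun e he => by rw [ha, if_pos he, mul_one]
  have h3 : ‖L a μ‖ = ∑ e ∈ F, lam e := by
    rw [h2, Complex.norm_real, Real.norm_of_nonneg (Finset.sum_nonneg fun e _ => (hlam _).le)]
  rw [← h3]
  refine ((L a).norm_apply_le μ).trans ((L.le_opNorm a).trans ?_)
  exact mul_le_of_le_one_right (norm_nonneg _) (norm_sum_cylFun_edge_le _)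

theorem IsTransferOperator.sourceSumsBounded (hlam : ∀ e, 0 < lam e)
    (hL : E.IsTransferOperator lam L) : E.SourceSumsBounded lam := by
  refine ⟨fun v _ => summable_of_sum_le (fun e => (hlam e).le) (hL.sum_le hlam v),
    memℓp_infty ⟨‖L‖, ?_⟩⟩
  rintro _ ⟨v, rfl⟩
  dsimp only
  rw [Real.norm_of_nonneg (tsum_nonneg fun e => (hlam _).le)]
  exact Real.tsum_le_of_sum_le (fun e => (hlam e).le) (hL.sum_le hlam v)

/-- χ_{D_v}(eμ) is 1 exactly when r(e) = v. The value therefore depends on μ only through its range.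
-/
theorem IsTransferOperator.hasSum_vertex (hL : E.IsTransferOperator lam L) (v : V)
    (μ : E.Boundary) :
    HasSum (fun e : {e : Edge // E.r e = v ∧ E.s e = μ.range} => lam e)
      (L (cylFun (.vertex E v)) μ).re := by
  have h := Complex.hasSum_re (hL (cylFun (.vertex E v)) μ)
  have h1 : HasSum ({e | E.s e = μ.range}.indicator ({e | E.r e = v}.indicator lam))
      (L (cylFun (.vertex E v)) μ).re := by
    refine hasSum_subtype_iff_indicator.1 ((congrArg (HasSum · _) (funext fun e => ?_)).mp h)
    by_cases he : E.r e = v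
    · rw [cylFun_apply_of_mem (mem_cylinder_vertex.2 (by simpa using he)), Function.comp_apply,
        Set.indicator_of_mem (show (e : Edge) ∈ {e | E.r e = v} from he), mul_one,
        Complex.ofReal_re]
    · rw [cylFun_apply_of_notMem (mt mem_cylinder_vertex.1 (by simpa using he)),
        Function.comp_apply,
        Set.indicator_of_notMem (show (e : Edge) ∉ {e | E.r e = v} from he), mul_zero,
        Complex.zero_re]
  refine (hasSum_subtype_iff_indicator (s := {e | E.r e = v ∧ E.s e = μ.range})).2 ?_
  rw [Set.indicator_indicator] at h1
  refine (congrArg (fun s : Set Edge => HasSum (s.indicator lam) _) ?_).mp h1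
  ext e
  exact and_comm

theorem IsTransferOperator.rangeSumsVanish (hL : E.IsTransferOperator lam L) :
    E.RangeSumsVanish lam := by
  intro v _
  refine ⟨fun w _ => ?_, ?_⟩
  · obtain ⟨μ, rfl⟩ := E.exists_boundary_range_eq w
    exact (hL.hasSum_vertex v μ).summable
  · rw [Metric.tendsto_nhds]
    intro ε hε
    obtain ⟨t, ht, htf⟩ := mem_cocompact.1
      ((L (cylFun (.vertex E v))).zero_at_infty'.eventually (Metric.ball_mem_nhds 0 hε))
    -- The open sets D_w cover ∂E, so the compact set outside which L χ_{D_v} is small contains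
    -- paths with only finitely many ranges.
    obtain ⟨W, hW⟩ := ht.elim_finite_subcover (fun w : V => E.cylinder (.vertex E w))
      (fun w => (isClopen_cylinder _).isOpen)
      (fun μ _ => Set.mem_iUnion.2 ⟨μ.range, mem_cylinder_vertex.2 rfl⟩)
    refine (W.finite_toSet.preimage Subtype.val_injective.injOn).subset ?_
    rintro ⟨w, hw⟩ hwε
    by_contra hwW
    refine hwε ?_
    obtain ⟨μ, rfl⟩ := E.exists_boundary_range_eq w
    have hμ : μ ∉ t := fun hμ => by
      obtain ⟨w', hw', h⟩ := Set.mem_iUnion₂.1 (hW hμ)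
      exact hwW ((mem_cylinder_vertex.1 h) ▸ hw')
    have h1 : dist (L (cylFun (.vertex E v)) μ) 0 < ε := htf hμ
    change dist (∑' e : {e : Edge // E.r e = v ∧ E.s e = μ.range}, lam e) 0 < ε
    rw [(hL.hasSum_vertex v μ).tsum_eq]
    rw [dist_zero_right] at h1 ⊢
    exact (Complex.abs_re_le_norm _).trans_lt h1

end DirGraph

/-! ### The equivalence and the intertwining isomorphism -/

theorem mainTheorem10 {V : Type u} {Edge : Type v} [Countable V] [Countable Edge]
    (E : DirGraph V Edge) (lam : Edge → ℝ) (hlam : ∀ e, 0 < lam e) :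
    List.TFAE
      [∃ L : C₀(E.Boundary, ℂ) →L[ℂ] C₀(E.Boundary, ℂ), E.IsTransferOperator lam L,
       E.SourceSumsBounded lam ∧ E.RangeSumsVanish lam,
       ∃ m : 𝓜(ℂ, E.GraphCStar), E.IsULambda lam m,
       ∃ Φ : E.GraphCStar →CP E.GraphCStar, E.IsPerronFrobenius lam Φ] ∧
    ∀ (L : C₀(E.Boundary, ℂ) →L[ℂ] C₀(E.Boundary, ℂ)) (m : 𝓜(ℂ, E.GraphCStar))
      (Φ : E.GraphCStar →CP E.GraphCStar),
      E.IsTransferOperator lam L → E.IsULambda lam m → E.IsPerronFrobenius lam Φ →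
      (∀ a : E.GraphCStar,
        (Φ a : 𝓜(ℂ, E.GraphCStar)) = star m * (a : 𝓜(ℂ, E.GraphCStar)) * m) ∧
      ∃ ψ : E.diagonal ≃⋆ₐ[ℂ] C₀(E.Boundary, ℂ),
        (∀ η : E.FinPath, (ψ (E.diagProj η) : E.Boundary → ℂ) =
          (E.cylinder η).indicator 1) ∧
        ∀ a : E.diagonal, ∃ h : Φ a ∈ E.diagonal, ψ ⟨Φ a, h⟩ = L (ψ a) := by
  refine ⟨?_, fun L m Φ hL hm hΦ => ⟨fun a => ?_, E.diagonalEquiv, fun η => ?_, fun a =>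
    ⟨hΦ.apply_mem_diagonal hlam a.2, hΦ.diagonalEquiv_apply_eq hlam hL a⟩⟩⟩
  · tfae_have 1 → 2 := fun ⟨L, hL⟩ => ⟨hL.sourceSumsBounded hlam, hL.rangeSumsVanish⟩
    tfae_have 2 → 3 := fun ⟨hs, hr⟩ => DirGraph.exists_isULambda hlam hs hr
    tfae_have 3 → 4 := fun ⟨m, hm⟩ => ⟨_, hm.isPerronFrobenius hlam⟩
    tfae_have 4 → 1 := fun ⟨Φ, hΦ⟩ => hΦ.exists_isTransferOperator hlam
    tfae_finish
  -- Φ a and u_λ⋆ a u_λ are limits of the same net.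
  · rw [tendsto_nhds_unique (hΦ a) (hm.tendsto_conj hlam a)]
    exact m.coe_conj a
  · rw [DirGraph.diagonalEquiv_apply, DirGraph.diagonalHom_diagProj, DirGraph.coe_cylFun]
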